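/- **Conventions.** An action of a category $\mathcal V$ with finite products on a category $\mathcal C$ is a functor $\cdot:\mathcal V\times\mathcal C\to\mathcal C$ with natural isomorphisms $1\cdot B\cong B$ and $(A\times A')\cdot B\cong A\cdot(A'\cdot B)$ that are coherent with the monoidal structure given by the products of $\mathcal V$. It is an enrichment of $\mathcal C$ in $\mathcal V$ with copowers if every functor $-\cdot B:\mathcal V\to\mathcal C$ has a right adjoint $\mathcal C(B,-):\mathcal C\to\mathcal V$; then $(\mathcal V,\mathcal C)$ is an *enriched model*. It is a *distributive enriched model* if moreover $\mathcal V$ and $\mathcal C$ have finite coproducts and the canonical maps $0\to A\times 0$, $(A\times A')+(A\times A'')\to A\times(A'+A'')$, $0\to A\cdot 0$ and $(A\cdot B)+(A\cdot D)\to A\cdot(B+D)$ are isomorphisms. A *closed enriched model* is an enriched model $(\mathcal V,\mathcal C)$ such that $\mathcal V$ is cartesian closed with finite coproducts, and $\mathcal C$ has finite products, finite coproducts and powers, i.e. every functor $A\cdot-:\mathcal C\to\mathcal C$ has a right adjoint. An *embedding* of a distributive enriched model $(\mathcal V,\mathcal C)$ in a closed enriched model $(\mathcal V',\mathcal C')$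 consists of fully faithful functors $F:\mathcal V\to\mathcal V'$ and $G:\mathcal C\to\mathcal C'$, both preserving finite coproducts, with $F$ preserving finite products, and a natural isomorphism $\lambda_{A,B}:G(A\cdot B)\cong FA\cdot GB$, coherent with the unit and associativity isomorphisms of the two actions, such that the transpose $F(\mathcal C(B,D))\to\mathcal C'(GB,GD)$ of the composite $$F(\mathcal C(B,D))\cdot GB\xrightarrow{\lambda^{-1}}G(\mathcal C(B,D)\cdot B)\xrightarrow{G(\mathrm{ev})}GD$$ is an isomorphism for all $B,D$ in $\mathcal C$. For a category $\mathcal A$ with finite coproducts let $\mathrm{FP}(\mathcal A^{\mathrm{op}},\mathbf{Set})$ be the category of finite-product-preserving functors $\mathcal A^{\mathrm{op}}\to\mathbf{Set}$ and natural transformations, and let $\mathbf y_{\mathcal A}:\mathcal A\to\mathrm{FP}(\mathcal A^{\mathrm{op}},\mathbf{Set})$, $A\mapsto\mathcal A(-,A)$, be the Yoneda embedding. Here $\mathbf{Set}$ is the category of sets in a universe relative to which the categories $\mathcal A$, $\mathcal V$, $\mathcal C$ are small. **Proposition.** 1. For every category $\mathcal A$ with finite coproducts, $\mathbf y_{\mathcal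 A}$ exhibits $\mathrm{FP}(\mathcal A^{\mathrm{op}},\mathbf{Set})$ as the cocompletion of $\mathcal A$ as a category with finite coproducts. That is, $\mathrm{FP}(\mathcal A^{\mathrm{op}},\mathbf{Set})$ is cocomplete, $\mathbf y_{\mathcal A}$ preserves finite coproducts, and for every (locally small) cocomplete category $\mathcal B$: every finite-coproduct-preserving functor $F:\mathcal A\to\mathcal B$ is isomorphic to $E\circ\mathbf y_{\mathcal A}$ for some colimit-preserving functor $E:\mathrm{FP}(\mathcal A^{\mathrm{op}},\mathbf{Set})\to\mathcal B$; and for all colimit-preserving functors $E,E':\mathrm{FP}(\mathcal A^{\mathrm{op}},\mathbf{Set})\to\mathcal B$, every natural transformation $E\circ\mathbf y_{\mathcal A}\to E'\circ\mathbf y_{\mathcal A}$ is the restriction along $\mathbf y_{\mathcal A}$ of a unique natural transformation $E\to E'$. 2. Every distributive enriched model embeds in a closed enriched model. More precisely, for every distributive enriched model $(\mathcal V,\mathcal C)$, the pair $(\mathrm{FP}(\mathcal V^{\mathrm{op}},\mathbf{Set}),\mathrm{FP}(\mathcal C^{\mathrm{op}},\mathbf{Set}))$ carries the structure of a closed enriched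 model for which the Yoneda embeddings $\mathbf y_{\mathcal V}$ and $\mathbf y_{\mathcal C}$ form an embedding of $(\mathcal V,\mathcal C)$; in particular $\mathbf y_{\mathcal V}$ and $\mathbf y_{\mathcal C}$ preserve finite coproducts. -/

import Mathlib

open CategoryTheory Limits MonoidalCategory CartesianMonoidalCategory Opposite
open scoped MonoidalLeftAction

universe w u v u₁ v₁ u₂ v₂ u₃ v₃ u₄ v₄ t

noncomputable section

namespace ECBV

/-! ### Enriched models

A category with finite products is a `CartesianMonoidalCategory`, and an action of `V` on `C`
is Mathlib's `MonoidalLeftAction V C` for the cartesian monoidal structure; the object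
`A ⊙ₗ B` is the copower of `B : C` by `A : V`. -/

/-- An action of `V` (with finite products) on `C` is an enrichment of `C` in `V` with copowers
if every functor `(- ⊙ₗ B) : V ⥤ C` has a right adjoint. -/
class IsEnrichedModel (V : Type u₁) [Category.{v₁} V] [CartesianMonoidalCategory V]
    (C : Type u₂) [Category.{v₂} C] [MonoidalLeftAction V C] : Prop where
  isLeftAdjoint_actionRight (B : C) : (MonoidalLeftAction.actionRight V B).IsLeftAdjoint

attribute [instance] IsEnrichedModel.isLeftAdjoint_actionRight

/-- A distributive category: finite products and finite coproducts, such that the canonical maps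
`0 ⟶ A × 0` and `(A × B) + (A × C) ⟶ A × (B + C)` are isomorphisms. -/
class IsDistributiveCategory (V : Type u₁) [Category.{v₁} V] [CartesianMonoidalCategory V]
    [HasFiniteCoproducts V] : Prop where
  isIso_initial (A : V) : IsIso (initial.to (A ⊗ (⊥_ V)))
  isIso_coprod (A B C : V) : IsIso (coprodComparison (tensorLeft A) B C)

/-- A distributive enriched model: a distributive category `V` and a category `C` enriched in `V`
with copowers and enriched finite coproducts.  The coproducts of `C` are enriched when the
canonical maps `0 ⟶ A ⊙ₗ 0` and `(A ⊙ₗ B) + (A ⊙ₗ D) ⟶ A ⊙ₗ (B + D)` are isomorphisms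
(`0 ⟶ 0 ⊙ₗ B` and `(A ⊙ₗ D) + (B ⊙ₗ D) ⟶ (A + B) ⊙ₗ D` are then isomorphisms too, because
`(- ⊙ₗ D)` is a left adjoint). -/
class IsDistributiveEnrichedModel (V : Type u₁) [Category.{v₁} V] [CartesianMonoidalCategory V]
    (C : Type u₂) [Category.{v₂} C] [MonoidalLeftAction V C]
    [HasFiniteCoproducts V] [HasFiniteCoproducts C] : Prop
    extends IsEnrichedModel V C, IsDistributiveCategory V where
  isIso_action_initial (A : V) : IsIso (initial.to (A ⊙ₗ (⊥_ C) : C))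
  isIso_action_coprod (A : V) (B D : C) :
    IsIso (coprodComparison (MonoidalLeftAction.actionLeft C A) B D)

/-- A closed enriched model: `V` is cartesian closed with finite coproducts, and `C` is enriched
in `V` with copowers, powers, finite products and finite coproducts.

A power `Y ^ X` of `Y : C` by `X : V` represents
`Z ↦ Hom_V(X, C(Z, Y)) ≅ Hom_C(X ⊙ₗ Z, Y)`, so powers by `X` are a right adjoint of
`(X ⊙ₗ -) : C ⥤ C`. Products and coproducts of `C` are then automatically enriched. -/
class IsClosedEnrichedModel (V : Type u₁) [Category.{v₁} V] [CartesianMonoidalCategory V]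
    (C : Type u₂) [Category.{v₂} C] [MonoidalLeftAction V C] : Prop
    extends IsEnrichedModel V C where
  cartesianClosed : Nonempty (MonoidalClosed V)
  hasFiniteCoproducts_values : HasFiniteCoproducts V
  hasPowers (X : V) : (MonoidalLeftAction.actionLeft C X).IsLeftAdjoint
  hasFiniteProducts : HasFiniteProducts C
  hasFiniteCoproducts : HasFiniteCoproducts C

section EnrichedHom

variable (V : Type u₁) [Category.{v₁} V] [CartesianMonoidalCategory V]
  {C : Type u₂} [Category.{v₂} C] [MonoidalLeftAction V C] [IsEnrichedModel V C]

/-- The enrichment `C(B, D)`, an object of `V`. -/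
def enrichedHom (B D : C) : V :=
  (MonoidalLeftAction.actionRight V B).rightAdjoint.obj D

/-- The natural bijection `Hom_C(A ⊙ₗ B, D) ≃ Hom_V(A, C(B, D))`. -/
def enrichedHomEquiv (A : V) (B D : C) : (A ⊙ₗ B ⟶ D) ≃ (A ⟶ enrichedHom V B D) :=
  (Adjunction.ofIsLeftAdjoint (MonoidalLeftAction.actionRight V B)).homEquiv A D

/-- The evaluation `C(B, D) ⊙ₗ B ⟶ D`. -/
def enrichedEv (B D : C) : enrichedHom V B D ⊙ₗ B ⟶ D :=
  (Adjunction.ofIsLeftAdjoint (MonoidalLeftAction.actionRight V B)).counit.app D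

end EnrichedHom

section Morphisms

variable {V : Type u₁} [Category.{v₁} V] [CartesianMonoidalCategory V]
  {C : Type u₂} [Category.{v₂} C] [MonoidalLeftAction V C] [IsEnrichedModel V C]
  {V' : Type u₃} [Category.{v₃} V'] [CartesianMonoidalCategory V']
  {C' : Type u₄} [Category.{v₄} C'] [MonoidalLeftAction V' C'] [IsEnrichedModel V' C']

/-- The structure making functors `F : V ⥤ V'` and `G : C ⥤ C'` a morphism of enriched models
`(V, C) ⟶ (V', C')`: `F` preserves finite products, and there is a coherent natural isomorphism
`G (A ⊙ₗ B) ≅ F A ⊙ₗ G B` for which the induced comparison `F (C(B, D)) ⟶ C'(G B, G D)` is an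
isomorphism. -/
structure EnrichedModelHom (F : V ⥤ V') (G : C ⥤ C') where
  preservesFiniteProducts : PreservesFiniteProducts F
  /-- The comparison of copowers. -/
  lam (A : V) (B : C) : G.obj (A ⊙ₗ B) ≅ F.obj A ⊙ₗ G.obj B
  lam_naturality {A A' : V} {B B' : C} (f : A ⟶ A') (g : B ⟶ B') :
    G.map (f ⊙ₗₘ g) ≫ (lam A' B').hom = (lam A B).hom ≫ (F.map f ⊙ₗₘ G.map g)
  lam_unit (B : C) :
    (lam (𝟙_ V) B).hom ≫ toUnit (F.obj (𝟙_ V)) ⊵ₗ G.obj B ≫ (λₗ[V'] (G.obj B)).hom =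
      G.map (λₗ[V] B).hom
  lam_assoc (A B : V) (D : C) :
    G.map (αₗ A B D).hom ≫ (lam A (B ⊙ₗ D)).hom ≫ F.obj A ⊴ₗ (lam B D).hom =
      (lam (A ⊗ B) D).hom ≫ lift (F.map (fst A B)) (F.map (snd A B)) ⊵ₗ G.obj D ≫
        (αₗ (F.obj A) (F.obj B) (G.obj D)).hom
  /-- The mate of the inverse of `lam` is an isomorphism. -/
  isIso_mate (B D : C) :
    IsIso (enrichedHomEquiv V' (F.obj (enrichedHom V B D)) (G.obj B) (G.obj D)
      ((lam (enrichedHom V B D) B).inv ≫ G.map (enrichedEv V B D)))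

/-- The structure making a pair of functors an embedding of enriched models with sums:
a morphism of enriched models whose two functors are full, faithful, and preserve finite
coproducts. -/
structure DistributiveEnrichedModelEmbedding (F : V ⥤ V') (G : C ⥤ C') extends
    EnrichedModelHom F G where
  full_left : F.Full
  faithful_left : F.Faithful
  full_right : G.Full
  faithful_right : G.Faithful
  preservesFiniteCoproducts_left : PreservesFiniteCoproducts F
  preservesFiniteCoproducts_right : PreservesFiniteCoproducts G

end Morphisms

/-! ### Finite-product-preserving presheaves -/

/-- The category `FP(Aᵒᵖ, Set)` of functors `Aᵒᵖ ⥤ Set` that preserve finite products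
(that is, that send finite coproducts of `A` to products), with all natural transformations. -/
abbrev FP (A : Type u) [Category.{v} A] : Type (max u v (w + 1)) :=
  ObjectProperty.FullSubcategory
    (fun P : Aᵒᵖ ⥤ Type w => PreservesFiniteProducts P)

/-- The Yoneda embedding `X ↦ Hom(-, X)`, as a functor `A ⥤ FP(Aᵒᵖ, Set)`.  The hom-sets are
lifted to the universe in which the presheaves take their values. -/
def yonedaFP (A : Type u) [Category.{v} A] : A ⥤ FP.{max w v} A :=
  ObjectProperty.lift _ uliftYoneda.{w} (fun X => by
    change PreservesFiniteProducts (yoneda.obj X ⋙ uliftFunctor.{w})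
    infer_instance)

/-- `y : A ⥤ D` exhibits `D` as the cocompletion of `A` as a category with finite coproducts:
`D` has all (`w`-small) colimits, `y` preserves finite coproducts, and every finite-coproduct
preserving functor `F : A ⥤ B` into a cocomplete category extends along `y` to a
colimit-preserving functor, uniquely up to unique isomorphism; indeed natural transformations
between colimit-preserving functors correspond to those between their restrictions along `y`. -/
structure IsFiniteCoproductCocompletion {A : Type u₁} [Category.{v₁} A]
    {D : Type u₂} [Category.{v₂} D] (y : A ⥤ D) : Prop where
  hasColimits : HasColimitsOfSize.{w, w} D
  preservesFiniteCoproducts : PreservesFiniteCoproducts y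
  exists_extension (B : Type t) [Category.{w} B] [HasColimitsOfSize.{w, w} B] (F : A ⥤ B)
    (hF : PreservesFiniteCoproducts F) :
    ∃ E : D ⥤ B, PreservesColimitsOfSize.{w, w} E ∧ Nonempty (y ⋙ E ≅ F)
  existsUnique_hom (B : Type t) [Category.{w} B] [HasColimitsOfSize.{w, w} B] (E E' : D ⥤ B)
    (hE : PreservesColimitsOfSize.{w, w} E) (hE' : PreservesColimitsOfSize.{w, w} E')
    (α : y ⋙ E ⟶ y ⋙ E') :
    ∃! β : E ⟶ E', Functor.whiskerLeft y β = α

end ECBV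

end

noncomputable section

namespace ECBV

/-! ### Presheaves preserving finite products as local objects -/

section Local

variable {A : Type u} [Category.{v} A]

/-! Preserving finite products is an orthogonality condition: by Yoneda it means being local for the
maps `y X + y Y ⟶ y (X + Y)` and `0 ⟶ y 0`. These form a small family of maps between finitely
presentable presheaves, so `FP A` is reflective in presheaves and hence cocomplete
(`isRightAdjoint_ι_FP`). If `F : A ⥤ B` preserves finite coproducts, every `B(F -, b)` lies in `FP
A`, so the Kan extension of `F` to presheaves restricts to a left adjoint on `FP A`. Since `y` is
dense, a colimit-preserving functor is the Kan extension of its own restriction, which gives the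
bijection on natural transformations.

For models, the copower of `B` by `P` corepresents the families `P X × B Y → D (X ⊙ₗ Y)` natural in
both variables; it is the reflection of a Kan extension along the action (`exists_universal_bilin`).
Morphisms out of it are built and compared on pure tensors. Because `X ⊙ₗ -` preserves finite
coproducts, `D (X ⊙ₗ -)` is again in `FP`, so one variable can be frozen and nested copowers treated
in the same way. An element of `P × Q` is a pair over one object, while a pure tensor pairs elements
over two; diagonals and projections of `V` translate between the two, which yields the coherent
action.

The right adjoints are explicit (`homFP`): the enriched hom is `X ↦ Hom(B, D (X ⊙ₗ -))`, the power
is `Y ↦ Hom(P, D (- ⊙ₗ Y))`, and exponentials are the same construction for `⊗`. They preserve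
finite products because the action and the product preserve finite coproducts in each variable. The
comparison of enriched homs is invertible by Yoneda (`isIso_mate_yonedaLam`). -/

/-- A binary fan of types is a limit if and only if the pairing of its legs is bijective. -/
lemma nonempty_isLimit_binaryFan_iff {X Y Z : Type w} (f : Z ⟶ X) (g : Z ⟶ Y) :
    Nonempty (IsLimit (BinaryFan.mk f g)) ↔ Function.Bijective (fun z : Z => (f z, g z)) := by
  rw [(Types.binaryProductLimit X Y).nonempty_isLimit_iff_isIso_lift, isIso_iff_bijective]
  rfl

variable [HasFiniteCoproducts A]

/-- A presheaf preserves finite products if and only if it sends binary coproducts to products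
and the initial object to a singleton. -/
lemma preservesFiniteProducts_iff_bijective (P : Aᵒᵖ ⥤ Type w) :
    PreservesFiniteProducts P ↔
      (∀ X Y : A, Function.Bijective (fun t : P.obj (op (X ⨿ Y)) =>
        (P.map (coprod.inl : X ⟶ X ⨿ Y).op t, P.map (coprod.inr : Y ⟶ X ⨿ Y).op t))) ∧
      Nonempty (Unique (P.obj (op (⊥_ A)))) := by
  constructor
  · intro _
    refine ⟨fun X Y => ?_, ?_⟩
    · rw [← nonempty_isLimit_binaryFan_iff]
      exact ⟨mapIsLimitOfPreservesOfIsLimit P _ _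
        (BinaryCofan.IsColimit.op (c := .mk coprod.inl coprod.inr) (coprodIsCoprod X Y))⟩
    · exact ⟨Types.isTerminalEquivUnique _
        (IsTerminal.isTerminalObj P _ (terminalOpOfInitial initialIsInitial))⟩
  · rintro ⟨h, ⟨h₀⟩⟩
    have : PreservesLimitsOfShape (Discrete WalkingPair) P := ⟨by
      intro K
      have : PreservesLimit (pair (op (K.obj ⟨WalkingPair.left⟩).unop)
          (op (K.obj ⟨WalkingPair.right⟩).unop)) P := by
        refine preservesLimit_of_preserves_limit_cone
          (BinaryCofan.IsColimit.op (c := .mk coprod.inl coprod.inr) (coprodIsCoprod _ _)) ?_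
        refine (isLimitMapConeBinaryFanEquiv P _ _).symm ?_
        exact ((nonempty_isLimit_binaryFan_iff _ _).2 (h _ _)).some
      exact preservesLimit_of_iso_diagram P (diagramIsoPair K).symm⟩
    have : PreservesLimit (Functor.empty.{0} Aᵒᵖ) P :=
      preservesTerminal_of_iso P
        (P.mapIso (terminalIsTerminal.uniqueUpToIso (terminalOpOfInitial initialIsInitial)) ≪≫
          ((Types.isTerminalEquivUnique _).symm h₀).uniqueUpToIso terminalIsTerminal)
    have : PreservesLimitsOfShape (Discrete.{0} PEmpty) P :=
      preservesLimitsOfShape_pempty_of_preservesTerminal P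
    exact .of_preserves_binary_and_terminal P

/-- The canonical morphisms `y X + y Y ⟶ y (X + Y)` and `0 ⟶ y 0` of presheaves. -/
def coproductMaps (A : Type u) [Category.{v} A] [HasFiniteCoproducts A] :
    MorphismProperty (Aᵒᵖ ⥤ Type (max w v)) :=
  MorphismProperty.ofHoms
      (fun i : A × A => coprodComparison uliftYoneda.{w} i.1 i.2) ⊔
    MorphismProperty.ofHoms
      (fun _ : PUnit.{v + 1} => initial.to (uliftYoneda.{w}.obj (⊥_ A)))

/-- Under Yoneda, precomposition with `y X + y Y ⟶ y (X + Y)` becomes the pairing `P (X + Y) → P X ×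
P Y`, and precomposition with `0 ⟶ y 0` becomes the map from `P 0` to a singleton. -/
lemma preservesFiniteProducts_iff_isLocal (P : Aᵒᵖ ⥤ Type (max w v)) :
    PreservesFiniteProducts P ↔ (coproductMaps.{w} A).isLocal P := by
  have hpair (X Y : A) : Function.Bijective (fun t : P.obj (op (X ⨿ Y)) =>
        (P.map (coprod.inl : X ⟶ X ⨿ Y).op t, P.map (coprod.inr : Y ⟶ X ⨿ Y).op t)) ↔
      Function.Bijective (fun g : uliftYoneda.{w}.obj (X ⨿ Y) ⟶ P =>
        coprodComparison uliftYoneda.{w} X Y ≫ g) := by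
    let e : (uliftYoneda.{w}.obj X ⨿ uliftYoneda.{w}.obj Y ⟶ P) ≃
        P.obj (op X) × P.obj (op Y) :=
      { toFun f := (uliftYonedaEquiv (coprod.inl ≫ f), uliftYonedaEquiv (coprod.inr ≫ f))
        invFun p := coprod.desc (uliftYonedaEquiv.symm p.1) (uliftYonedaEquiv.symm p.2)
        left_inv f := coprod.hom_ext
          ((coprod.inl_desc _ _).trans (Equiv.symm_apply_apply _ _))
          ((coprod.inr_desc _ _).trans (Equiv.symm_apply_apply _ _))
        right_inv p := Prod.ext
          ((congrArg _ (coprod.inl_desc _ _)).trans (Equiv.apply_symm_apply _ _))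
          ((congrArg _ (coprod.inr_desc _ _)).trans (Equiv.apply_symm_apply _ _)) }
    rw [← Function.Bijective.of_comp_iff' e.bijective,
      ← Function.Bijective.of_comp_iff _ uliftYonedaEquiv.{w}.symm.bijective]
    apply iff_of_eq
    congr 1
    funext t
    exact Prod.ext
      (by
        change _ = uliftYonedaEquiv (coprod.inl ≫ coprodComparison uliftYoneda.{w} X Y ≫ _)
        rw [← Category.assoc, coprodComparison_inl]
        exact ((uliftYonedaEquiv_naturality _ coprod.inl.op).symm.trans
          (congrArg _ (Equiv.apply_symm_apply _ t))).symm)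
      (by
        change _ = uliftYonedaEquiv (coprod.inr ≫ coprodComparison uliftYoneda.{w} X Y ≫ _)
        rw [← Category.assoc, coprodComparison_inr]
        exact ((uliftYonedaEquiv_naturality _ coprod.inr.op).symm.trans
          (congrArg _ (Equiv.apply_symm_apply _ t))).symm)
  have hinit : Nonempty (Unique (P.obj (op (⊥_ A)))) ↔
      Function.Bijective (fun g : uliftYoneda.{w}.obj (⊥_ A) ⟶ P =>
        initial.to (uliftYoneda.{w}.obj (⊥_ A)) ≫ g) := by
    rw [← Function.Bijective.of_comp_iff _ uliftYonedaEquiv.{w}.symm.bijective]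
    constructor
    · rintro ⟨h⟩
      exact ⟨fun _ _ _ => Subsingleton.elim _ _, fun _ => ⟨default, Subsingleton.elim _ _⟩⟩
    · intro h
      exact ⟨(Equiv.ofBijective _ h).unique⟩
  rw [preservesFiniteProducts_iff_bijective]
  simp only [hpair, hinit]
  constructor
  · rintro ⟨h₁, h₂⟩ _ _ _ (⟨⟨X, Y⟩⟩ | ⟨⟨⟩⟩)
    exacts [h₁ X Y, h₂]
  · intro h
    exact ⟨fun X Y => h _ (.inl ⟨(X, Y)⟩), h _ (.inr ⟨⟨⟩⟩)⟩

lemma isLocal_coproductMaps :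
    (coproductMaps.{w} A).isLocal = fun P => PreservesFiniteProducts P :=
  funext fun P => propext (preservesFiniteProducts_iff_isLocal P).symm

instance isClosedUnderLimitsOfShape_FP (J : Type u₁) [Category.{v₁} J] :
    ObjectProperty.IsClosedUnderLimitsOfShape
      (fun P : Aᵒᵖ ⥤ Type (max w v) => PreservesFiniteProducts P) J :=
  isLocal_coproductMaps.{w} (A := A) ▸ inferInstance

end Local

/-! ### Reflectivity in presheaves, and colimits -/

section Reflective

variable {A : Type u} [Category.{v} A]

attribute [local instance] Cardinal.fact_isRegular_aleph0

/-- By Yoneda, homs out of a representable are evaluation at `X`, and colimits of presheaves are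
computed pointwise. -/
instance isCardinalPresentable_uliftYoneda (X : A) :
    IsCardinalPresentable (uliftYoneda.{max w u}.obj X) Cardinal.aleph0.{max w u v} where
  preservesColimitOfShape J _ _ := by
    let e : coyoneda.obj (op (uliftYoneda.{max w u}.obj X)) ≅
        (evaluation Aᵒᵖ (Type (max w u v))).obj (op X) :=
      NatIso.ofComponents (fun P => Equiv.toIso uliftYonedaEquiv)
    exact preservesColimitsOfShape_of_natIso e.symm

variable [HasFiniteCoproducts A]

/-- An instance of the orthogonal subcategory theorem: the local objects for a small family of maps
with presentable sources and targets are reflective. The sources are finite coproducts of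
representables, hence still finitely presentable. -/
lemma isRightAdjoint_ι_FP :
    (ObjectProperty.ι (fun P : Aᵒᵖ ⥤ Type (max w u v) =>
      PreservesFiniteProducts P)).IsRightAdjoint := by
  have : MorphismProperty.IsSmall.{max w u v} (coproductMaps.{max w u} A) := by
    -- The maps are indexed by pairs of objects of `A`, so the universe of values has to contain
    -- that of `A`.
    have : Small.{max w u v} A := small_max.{max w v} A
    refine ⟨?_⟩
    rw [coproductMaps, MorphismProperty.toSet_max]
    infer_instance
  have := MorphismProperty.isRightAdjoint_ι_isLocal (coproductMaps.{max w u} A)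
    Cardinal.aleph0.{max w u v} ?_
  · rwa [isLocal_coproductMaps] at this
  · rintro _ _ _ (⟨⟨X, Y⟩⟩ | ⟨⟨⟩⟩)
    · refine ⟨?_, isCardinalPresentable_uliftYoneda _⟩
      have : ∀ k, IsCardinalPresentable ((pair (uliftYoneda.{max w u}.obj X)
        (uliftYoneda.{max w u}.obj Y)).obj k) Cardinal.aleph0.{max w u v} := by
        rintro ⟨_ | _⟩
        exacts [isCardinalPresentable_uliftYoneda X, isCardinalPresentable_uliftYoneda Y]
      exact isCardinalPresentable_of_isColimit' _ (coprodIsCoprod (uliftYoneda.{max w u}.obj X)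
        (uliftYoneda.{max w u}.obj Y)) _ ((hasCardinalLT_aleph0_iff _).2 inferInstance)
    · refine ⟨?_, isCardinalPresentable_uliftYoneda _⟩
      have : ∀ k, IsCardinalPresentable ((Functor.empty.{0} (Aᵒᵖ ⥤ Type (max w u v))).obj k)
        Cardinal.aleph0.{max w u v} := by
        rintro ⟨⟨⟩⟩
      exact isCardinalPresentable_of_isColimit' _
        (initialIsInitial (C := Aᵒᵖ ⥤ Type (max w u v))) _
        ((hasCardinalLT_aleph0_iff _).2 inferInstance)

lemma hasColimitsOfSize_FP : HasColimitsOfSize.{max w u v, max w u v} (FP.{max w u v} A) := by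
  have := isRightAdjoint_ι_FP.{w} (A := A)
  have : Reflective (ObjectProperty.ι (fun P : Aᵒᵖ ⥤ Type (max w u v) =>
    PreservesFiniteProducts P)) :=
    { L := _, adj := Adjunction.ofIsRightAdjoint _ }
  exact hasColimits_of_reflective (ObjectProperty.ι _)

lemma hasFiniteCoproducts_FP : HasFiniteCoproducts (FP.{max w u v} A) := by
  have := hasColimitsOfSize_FP.{w} (A := A)
  have := hasColimitsOfSizeShrink.{0, 0, max w u v, max w u v} (FP.{max w u v} A)
  infer_instance

end Reflective

/-! ### The Yoneda embedding into finite-product-preserving presheaves -/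

section Generalities

variable {A : Type u} [Category.{v} A] {D : Type u₁} [Category.{v₁} D]

/-- The opposite of a cocone on a discrete diagram is a cone indexed by the opposite of the discrete
category; this absorbs the change of shape. -/
lemma preservesLimitsOfShape_op_discrete (P : Aᵒᵖ ⥤ D) [PreservesFiniteProducts P] (n : ℕ) :
    PreservesLimitsOfShape (Discrete (Fin n))ᵒᵖ P :=
  preservesLimitsOfShape_of_equiv (Discrete.opposite (Fin n)).symm P

/-- A functor preserves finite coproducts if all the presheaves that it represents preserve finite
products. -/
lemma preservesFiniteCoproducts_of_yoneda (F : A ⥤ D)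
    (h : ∀ X : D, PreservesFiniteProducts (F.op ⋙ yoneda.obj X)) :
    PreservesFiniteCoproducts F where
  preserves n := ⟨fun {K} => ⟨fun {c} hc => ⟨(F.mapCocone c).isColimitYonedaEquiv.symm
    fun X => by
      have := preservesLimitsOfShape_op_discrete (F.op ⋙ yoneda.obj X) n
      exact isLimitOfPreserves (F.op ⋙ yoneda.obj X) hc.op⟩⟩⟩

end Generalities

section Yoneda

variable {A : Type u} [Category.{v} A]

/-- The Yoneda lemma for `FP`. -/
def yonedaFPEquiv {X : A} {P : FP.{max w v} A} :
    ((yonedaFP.{w} A).obj X ⟶ P) ≃ P.obj.obj (op X) :=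
  (ObjectProperty.fullyFaithfulι _).homEquiv.trans uliftYonedaEquiv.{w}

/-- The presheaf represented by `P` on the image of the Yoneda embedding is `P` itself. -/
def yonedaFPOpCompYonedaIso (P : FP.{max w u v} A) :
    (yonedaFP.{max w u} A).op ⋙ yoneda.obj P ≅ P.obj :=
  NatIso.ofComponents (fun X => Equiv.toIso yonedaFPEquiv.{max w u}) (by
    intro X Y f
    ext g
    exact (uliftYonedaEquiv_naturality g.hom f).symm)

instance : (yonedaFP.{w} A).Full :=
  inferInstanceAs (ObjectProperty.lift _ _ _).Full

instance : (yonedaFP.{w} A).Faithful :=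
  inferInstanceAs (ObjectProperty.lift _ _ _).Faithful

/-- `Hom(y -, P)` is `P` itself, which preserves finite products because it belongs to `FP`. In all
presheaves this would fail. -/
instance preservesFiniteCoproducts_yonedaFP :
    PreservesFiniteCoproducts (yonedaFP.{max w u} A) :=
  preservesFiniteCoproducts_of_yoneda _ fun P => by
    have := P.property
    exact ⟨fun n => preservesLimitsOfShape_of_natIso (yonedaFPOpCompYonedaIso P).symm⟩

/-- Restriction of representables along the Yoneda embedding is the inclusion into presheaves. -/
def restrictedULiftYonedaFPIso :
    Presheaf.restrictedULiftYoneda.{max w u v} (yonedaFP.{max w u} A) ≅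
      ObjectProperty.ι (fun P : Aᵒᵖ ⥤ Type (max w u v) => PreservesFiniteProducts P) :=
  NatIso.ofComponents (fun P => NatIso.ofComponents
    (fun X => Equiv.toIso (Equiv.ulift.trans yonedaFPEquiv.{max w u})) (by
      intro X Y f
      ext ⟨g⟩
      exact (uliftYonedaEquiv_naturality g.hom f).symm)) (by
    intro P Q f
    ext X ⟨g⟩
    rfl)

/-- Density amounts to full faithfulness of the nerve, and the nerve of `y` is the inclusion of a
full subcategory. -/
instance : (yonedaFP.{max w u} A).IsDense :=
  Functor.IsDense.of_fullyFaithful_restrictedULiftYoneda.{max w u v}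
    ((ObjectProperty.fullyFaithfulι _).ofIso restrictedULiftYonedaFPIso.symm)

end Yoneda

/-! ### The universal property of the cocompletion -/

section Cocompletion

variable {A : Type u} [Category.{v} A]
  {B : Type t} [Category.{max w u v} B]

/-- A finite-coproduct-preserving functor extends along the Yoneda embedding to a left adjoint. -/
lemma exists_extension_yonedaFP [HasColimitsOfSize.{max w u v, max w u v} B] (F : A ⥤ B)
    [PreservesFiniteCoproducts F] :
    ∃ E : FP.{max w u v} A ⥤ B, E.IsLeftAdjoint ∧
      Nonempty (yonedaFP.{max w u} A ⋙ E ≅ F) := by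
  have : HasColimitsOfSize.{v, max w u v} B :=
    hasColimitsOfSizeShrink.{v, max w u v, max w u v, max w u v} B
  let y : A ⥤ Aᵒᵖ ⥤ Type (max w u v) := uliftYoneda.{max w u v}
  let L : (Aᵒᵖ ⥤ Type (max w u v)) ⥤ B := uliftYoneda.{max w u v}.leftKanExtension F
  let R : B ⥤ Aᵒᵖ ⥤ Type (max w u v) := Presheaf.restrictedULiftYoneda.{max w v} F
  let adj : L ⊣ R := Presheaf.uliftYonedaAdjunction.{w} _ (uliftYoneda.leftKanExtensionUnit F)
  -- `B(F -, b)` turns the finite coproducts preserved by `F` into products.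
  have hR (b : B) : PreservesFiniteProducts (R.obj b) := by
    have := preservesFiniteProducts_op F
    change PreservesFiniteProducts (F.op ⋙ yoneda.obj b ⋙ uliftFunctor.{max w v})
    infer_instance
  let i := ObjectProperty.ι (fun P : Aᵒᵖ ⥤ Type (max w u v) => PreservesFiniteProducts P)
  let e : yonedaFP.{max w u} A ⋙ i ≅ y :=
    NatIso.ofComponents (fun X => NatIso.ofComponents
      (fun Y => Equiv.toIso (Equiv.ulift.trans Equiv.ulift.symm)))
  -- The inclusion `i` need not preserve colimits, but `i ⋙ L` does: `R` takes values in `FP A`, so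
  -- its corestriction is right adjoint to `i ⋙ L`.
  refine ⟨i ⋙ L, ⟨ObjectProperty.lift _ R hR, ⟨adj.restrictFullyFaithful
    (ObjectProperty.fullyFaithfulι _) (Functor.FullyFaithful.id B) (Iso.refl _) (Iso.refl _)⟩⟩,
    ⟨(Functor.associator _ _ _).symm ≪≫ Functor.isoWhiskerRight e L ≪≫
      Presheaf.isExtensionAlongULiftYoneda.{w} F⟩⟩

/-- By density the identity of `FP A` is the pointwise left Kan extension of `y` along itself; `E`
preserves the colimits that compute it. -/
lemma isLeftKanExtension_yonedaFP (E : FP.{max w u v} A ⥤ B)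
    [PreservesColimitsOfSize.{max w u v, max w u v} E] :
    E.IsLeftKanExtension (𝟙 (yonedaFP.{max w u} A ⋙ E)) := by
  have : PreservesColimitsOfSize.{v, max w u v} E :=
    preservesColimitsOfSize_shrink.{max w u v, max w u v, v, max w u v} E
  have : E.PreservesPointwiseLeftKanExtension (yonedaFP.{max w u} A) (yonedaFP.{max w u} A) :=
    fun P => by
      infer_instance
  have := Functor.PreservesLeftKanExtension.preserves (G := E) (𝟭 _)
    (yonedaFP.{max w u} A).rightUnitor.inv
  exact Functor.isLeftKanExtension_of_iso E.leftUnitor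
    (Functor.whiskerRight (yonedaFP.{max w u} A).rightUnitor.inv E ≫
      (Functor.associator _ (𝟭 _) E).hom) _ (by ext; simp)

theorem isFiniteCoproductCocompletion_yonedaFP [HasFiniteCoproducts A] :
    IsFiniteCoproductCocompletion.{max w u v, u, v, max (w + 1) (u + 1) (v + 1),
        max w u v, t} (yonedaFP.{max w u} A) where
  hasColimits := hasColimitsOfSize_FP.{w}
  preservesFiniteCoproducts := inferInstance
  exists_extension B _ _ F hF := by
    obtain ⟨E, hE, h⟩ := exists_extension_yonedaFP.{w} F
    exact ⟨E, (Adjunction.ofIsLeftAdjoint E).leftAdjoint_preservesColimits, h⟩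
  existsUnique_hom B _ _ E E' hE hE' α := by
    have := isLeftKanExtension_yonedaFP.{w} E
    simpa [Functor.homEquivOfIsLeftKanExtension] using!
      (E.homEquivOfIsLeftKanExtension (𝟙 _) E').bijective.existsUnique α

end Cocompletion

/-! ### Elements of finite-product-preserving presheaves -/

section Elements

variable {A : Type u} [Category.{v} A]

/-- The elements of `P : FP A` over an object of `A`. -/
def El (P : FP.{w} A) (X : A) : Type w := P.obj.obj (op X)

/-- Restriction of elements along a morphism of `A`. -/
def res {P : FP.{w} A} {X Y : A} (f : X ⟶ Y) (x : El P Y) : El P X := P.obj.map f.op x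

/-- The action of a morphism of presheaves on elements. -/
def ap {P Q : FP.{w} A} (φ : P ⟶ Q) {X : A} (x : El P X) : El Q X := φ.hom.app (op X) x

variable {P Q R : FP.{w} A} {X Y Z : A}

@[simp] lemma res_id (x : El P X) : res (𝟙 X) x = x :=
  P.obj.map_id_apply _ x

lemma res_comp (f : X ⟶ Y) (g : Y ⟶ Z) (x : El P Z) : res (f ≫ g) x = res f (res g x) :=
  P.obj.map_comp_apply g.op f.op x

@[simp] lemma res_res (f : X ⟶ Y) (g : Y ⟶ Z) (x : El P Z) : res f (res g x) = res (f ≫ g) x :=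
  (res_comp f g x).symm

@[simp] lemma ap_res (φ : P ⟶ Q) (f : X ⟶ Y) (x : El P Y) : ap φ (res f x) = res f (ap φ x) :=
  NatTrans.naturality_apply φ.hom f.op x

@[simp] lemma ap_id (x : El P X) : ap (𝟙 P) x = x := rfl

@[simp] lemma ap_comp (φ : P ⟶ Q) (ψ : Q ⟶ R) (x : El P X) : ap (φ ≫ ψ) x = ap ψ (ap φ x) := rfl

lemma FP_hom_ext {φ ψ : P ⟶ Q} (h : ∀ (X : A) (x : El P X), ap φ x = ap ψ x) : φ = ψ := by
  apply ObjectProperty.hom_ext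
  ext ⟨X⟩ x
  exact h X x

/-- A family of maps on elements that is compatible with restrictions is a morphism. -/
def FPhomMk (app : ∀ X, El P X → El Q X)
    (h : ∀ {X Y : A} (f : X ⟶ Y) (x : El P Y), app X (res f x) = res f (app Y x)) : P ⟶ Q :=
  ObjectProperty.homMk
    { app X := ↾(app X.unop)
      naturality X Y f := by
        ext x
        exact h f.unop x }

@[simp] lemma ap_FPhomMk (app : ∀ X, El P X → El Q X)
    (h : ∀ {X Y : A} (f : X ⟶ Y) (x : El P Y), app X (res f x) = res f (app Y x)) (x : El P X) :
    ap (FPhomMk app h) x = app X x := rfl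

lemma isIso_of_bijective_ap (φ : P ⟶ Q)
    (h : ∀ X, Function.Bijective (fun x : El P X => ap φ x)) : IsIso φ := by
  have : IsIso φ.hom := by
    rw [NatTrans.isIso_iff_isIso_app]
    intro X
    exact (isIso_iff_bijective _).2 (h X.unop)
  exact (isIso_iff_of_reflects_iso φ (ObjectProperty.ι _)).1 this

/-- Precomposition with a functor that preserves finite coproducts. -/
def reindex {A' : Type u₁} [Category.{v₁} A'] (F : A ⥤ A') [PreservesFiniteCoproducts F]
    (D : FP.{w} A') : FP.{w} A where
  obj := F.op ⋙ D.obj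
  property := by
    have := D.property
    have := preservesFiniteProducts_op F
    infer_instance

end Elements

section ElementsYoneda

variable {A : Type u} [Category.{v} A] {P : FP.{max w v} A} {X Y Z : A}

/-- A morphism of `A`, as an element of a representable presheaf. -/
def yel (f : X ⟶ Y) : El ((yonedaFP.{w} A).obj Y) X := ULift.up f

lemma yel_surjective (x : El ((yonedaFP.{w} A).obj Y) X) : ∃ f : X ⟶ Y, yel f = x :=
  ⟨x.down, rfl⟩

@[simp] lemma res_yel (f : X ⟶ Y) (g : Y ⟶ Z) : res f (yel.{w} g) = yel (f ≫ g) := rfl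

@[simp] lemma ap_yonedaFP_map (f : X ⟶ Y) (g : Y ⟶ Z) :
    ap ((yonedaFP.{w} A).map g) (yel f) = yel (f ≫ g) := rfl

/-- The morphism from a representable presheaf that corresponds to an element. -/
def ydesc (x : El P X) : (yonedaFP.{w} A).obj X ⟶ P := yonedaFPEquiv.symm x

@[simp] lemma ap_ydesc (x : El P X) (f : Y ⟶ X) : ap (ydesc x) (yel f) = res f x := rfl

lemma yonedaFPEquiv_map_comp (f : X ⟶ Y) (φ : (yonedaFP.{w} A).obj Y ⟶ P) :
    yonedaFPEquiv ((yonedaFP.{w} A).map f ≫ φ) = ap φ (yel f) :=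
  congrArg (fun g => ap φ (yel g)) (Category.id_comp f)

lemma yoneda_hom_ext {f g : (yonedaFP.{w} A).obj X ⟶ P}
    (h : ap f (yel (𝟙 X)) = ap g (yel (𝟙 X))) : f = g :=
  yonedaFPEquiv.injective h

end ElementsYoneda

/-! ### Pointwise finite products -/

section Cartesian

variable {A : Type u} [Category.{v} A]

lemma preservesFiniteProducts_comp_uliftFunctor_iff (P : Aᵒᵖ ⥤ Type w) :
    PreservesFiniteProducts (P ⋙ uliftFunctor.{v}) ↔ PreservesFiniteProducts P :=
  ⟨fun _ => ⟨fun _ => preservesLimitsOfShape_of_reflects_of_preserves P uliftFunctor.{v}⟩,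
    fun _ => inferInstance⟩

/-- Lifting the values to a larger universe neither creates nor destroys preservation of products,
so the case of local objects, where the values contain the hom-sets, suffices. -/
instance isClosedUnderLimitsOfShape_preservesFiniteProducts [HasFiniteCoproducts A]
    (J : Type) [SmallCategory J] :
    ObjectProperty.IsClosedUnderLimitsOfShape
      (fun P : Aᵒᵖ ⥤ Type w => PreservesFiniteProducts P) J := by
  have : (fun P : Aᵒᵖ ⥤ Type w => PreservesFiniteProducts P) =
      ObjectProperty.inverseImage (fun P : Aᵒᵖ ⥤ Type (max w v) => PreservesFiniteProducts P)
        ((Functor.whiskeringRight Aᵒᵖ (Type w) (Type (max w v))).obj uliftFunctor.{v}) :=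
    funext fun P => propext (preservesFiniteProducts_comp_uliftFunctor_iff P).symm
  rw [this]
  infer_instance

variable [HasFiniteCoproducts A]

variable {P Q R P' Q' : FP.{w} A} {X Y : A}

/-- Pairs of elements are elements of the product. -/
def pairEl (x : El P X) (y : El Q X) : El (P ⊗ Q) X := (x, y)

/-- The element of the unit. -/
def unitEl (X : A) : El (𝟙_ (FP.{w} A)) X := PUnit.unit

lemma eq_unitEl (x : El (𝟙_ (FP.{w} A)) X) : x = unitEl X := rfl

lemma res_unitEl (f : Y ⟶ X) : res f (unitEl.{w} X) = unitEl Y := rfl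

@[simp] lemma ap_fst (x : El P X) (y : El Q X) : ap (fst P Q) (pairEl x y) = x := rfl

@[simp] lemma ap_snd (x : El P X) (y : El Q X) : ap (snd P Q) (pairEl x y) = y := rfl

@[simp] lemma pairEl_eta (x : El (P ⊗ Q) X) : pairEl (ap (fst P Q) x) (ap (snd P Q) x) = x := rfl

lemma exists_pairEl (x : El (P ⊗ Q) X) : ∃ p q, pairEl (P := P) (Q := Q) p q = x :=
  ⟨_, _, pairEl_eta x⟩

@[simp] lemma res_pairEl (f : Y ⟶ X) (x : El P X) (y : El Q X) :
    res f (pairEl x y) = pairEl (res f x) (res f y) := rfl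

@[simp] lemma ap_lift (f : R ⟶ P) (g : R ⟶ Q) (x : El R X) :
    ap (lift f g) x = pairEl (ap f x) (ap g x) := rfl

@[simp] lemma ap_tensorHom (f : P ⟶ P') (g : Q ⟶ Q') (x : El P X) (y : El Q X) :
    ap (f ⊗ₘ g) (pairEl x y) = pairEl (ap f x) (ap g y) := rfl

@[simp] lemma ap_whiskerLeft (g : Q ⟶ Q') (x : El P X) (y : El Q X) :
    ap (P ◁ g) (pairEl x y) = pairEl x (ap g y) := rfl

@[simp] lemma ap_whiskerRight (f : P ⟶ P') (x : El P X) (y : El Q X) :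
    ap (f ▷ Q) (pairEl x y) = pairEl (ap f x) y := rfl

@[simp] lemma ap_associator (x : El P X) (y : El Q X) (z : El R X) :
    ap (α_ P Q R).hom (pairEl (pairEl x y) z) = pairEl x (pairEl y z) := rfl

@[simp] lemma ap_leftUnitor (x : El P X) :
    ap (λ_ P).hom (pairEl (unitEl X) x) = x := rfl

@[simp] lemma ap_rightUnitor (x : El P X) :
    ap (ρ_ P).hom (pairEl x (unitEl X)) = x := rfl

end Cartesian

/-! ### Copowers of finite-product-preserving presheaves -/

section Bilinear

variable {V : Type u₁} [Category.{v₁} V] [CartesianMonoidalCategory V]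
  {C : Type u₂} [Category.{v₂} C] [MonoidalLeftAction V C]

/-- A family of maps `P v × B c → D (v ⊙ₗ c)`, natural in `v` and `c`. -/
@[ext]
structure Bilin (P : FP.{w} V) (B D : FP.{w} C) where
  app {X : V} {Y : C} (p : El P X) (b : El B Y) : El D (X ⊙ₗ Y)
  app_res {X X' : V} {Y Y' : C} (f : X' ⟶ X) (g : Y' ⟶ Y) (p : El P X) (b : El B Y) :
    app (res f p) (res g b) = res (f ⊙ₗₘ g) (app p b)

namespace Bilin

variable {P : FP.{w} V} {B D D' : FP.{w} C}

/-- Composition of a bilinear family with a morphism. -/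
def comp (β : Bilin P B D) (φ : D ⟶ D') : Bilin P B D' where
  app p b := ap φ (β.app p b)
  app_res f g p b := by rw [β.app_res, ap_res]

end Bilin

variable (V C) in
/-- The action, as a functor on the product category. -/
def actionFunctor : V × C ⥤ C where
  obj X := X.1 ⊙ₗ X.2
  map f := f.1 ⊙ₗₘ f.2

/-- The external product of two presheaves. -/
def externalProduct (P : FP.{w} V) (B : FP.{w} C) : (V × C)ᵒᵖ ⥤ Type w where
  obj X := El P X.unop.1 × El B X.unop.2
  map f := ↾fun x => (res f.unop.1 x.1, res f.unop.2 x.2)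
  map_id X := by ext x <;> simp
  map_comp f g := by ext x <;> simp

/-- Bilinear families are natural transformations out of the external product. -/
def bilinEquiv (P : FP.{w} V) (B D : FP.{w} C) :
    Bilin P B D ≃ (externalProduct P B ⟶ (actionFunctor V C).op ⋙ D.obj) where
  toFun β :=
    { app X := ↾fun x => β.app x.1 x.2
      naturality X Y f := by
        ext x
        exact β.app_res f.unop.1 f.unop.2 x.1 x.2 }
  invFun α :=
    { app {X Y} p b := α.app (op (X, Y)) (p, b)
      app_res {X X' Y Y'} f g p b :=
        ConcreteCategory.congr_hom (CC := fun X => X)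
          (α.naturality (X := op (X, Y)) (Y := op (X', Y')) (Prod.mkHom f g).op)
          ((p, b) : El P X × El B Y) }
  left_inv β := rfl
  right_inv α := rfl

end Bilinear

/-! ### Existence of the universal bilinear family -/

section Tensor

variable {V : Type u₁} [Category.{v₁} V] [CartesianMonoidalCategory V]
  {C : Type u₂} [Category.{v₂} C] [HasFiniteCoproducts C] [MonoidalLeftAction V C]

/-- The functor of bilinear families is corepresentable. -/
lemma exists_universal_bilin (P : FP.{max u₁ v₁ u₂ v₂} V) (B : FP.{max u₁ v₁ u₂ v₂} C) :
    ∃ (T : FP.{max u₁ v₁ u₂ v₂} C) (τ : Bilin P B T),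
      ∀ (D : FP.{max u₁ v₁ u₂ v₂} C),
        Function.Bijective (fun φ : T ⟶ D => τ.comp φ) := by
  have : HasColimitsOfSize.{max v₁ v₂, max u₁ u₂ v₂} (Type (max u₁ v₁ u₂ v₂)) := inferInstance
  -- The Kan extension of the external product along the action classifies bilinear families into
  -- arbitrary presheaves; its reflection does so within `FP`.
  let F := (actionFunctor V C).op
  let T₀ := F.leftKanExtension (externalProduct P B)
  have := isRightAdjoint_ι_FP.{max u₁ v₁} (A := C)
  let adj := Adjunction.ofIsRightAdjoint (ObjectProperty.ι
    (fun P : Cᵒᵖ ⥤ Type (max u₁ v₁ u₂ v₂) => PreservesFiniteProducts P))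
  let e (D : FP.{max u₁ v₁ u₂ v₂} C) : (_ ⟶ D) ≃ Bilin P B D :=
    (adj.homEquiv T₀ D).trans ((T₀.homEquivOfIsLeftKanExtension
      (F.leftKanExtensionUnit (externalProduct P B)) D.obj).trans (bilinEquiv P B D).symm)
  refine ⟨_, e _ (𝟙 _), fun D => ?_⟩
  -- The universal family corresponds to the identity, so naturality of `e` in `D` makes composition
  -- with it equal to `e D`.
  convert (e D).bijective using 1
  funext φ
  have h : adj.homEquiv T₀ D φ = adj.homEquiv T₀ _ (𝟙 _) ≫ φ.hom := by
    conv_lhs => rw [← Category.id_comp φ]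
    exact adj.homEquiv_naturality_right _ _
  change (e _ (𝟙 _)).comp φ = (bilinEquiv P B D).symm (F.leftKanExtensionUnit _ ≫
    Functor.whiskerLeft F (adj.homEquiv T₀ D φ))
  rw [h]
  rfl

end Tensor

/-! ### Diagonals and projections for an action of a cartesian category -/

section Diagonal

variable {V : Type u₁} [Category.{v₁} V] [CartesianMonoidalCategory V]
  {C : Type u₂} [Category.{v₂} C] [MonoidalLeftAction V C]

/-- The diagonal of an action. -/
def diag (X : V) (Y : C) : X ⊙ₗ Y ⟶ X ⊙ₗ (X ⊙ₗ Y) :=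
  lift (𝟙 X) (𝟙 X) ⊵ₗ Y ≫ (αₗ X X Y).hom

/-- The projection of an action. -/
def proj (X : V) (Y : C) : X ⊙ₗ Y ⟶ Y := toUnit X ⊵ₗ Y ≫ (λₗ Y).hom

/-- Naturality of the associator, together with the fact that the diagonal followed by `f × g` is
`lift f g`. Most later identities for `diag` are special cases. -/
lemma diag_comp_actionHom {X X₁ X₂ : V} {Y Y' : C} (f : X ⟶ X₁) (g : X ⟶ X₂) (h : Y ⟶ Y') :
    diag X Y ≫ (f ⊙ₗₘ (g ⊙ₗₘ h)) = (lift f g ⊙ₗₘ h) ≫ (αₗ X₁ X₂ Y').hom := by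
  rw [diag, Category.assoc, ← MonoidalLeftAction.actionAssocIso_hom_naturality,
    ← Category.assoc, ← MonoidalLeftAction.actionHom_id, ← MonoidalLeftAction.actionHom_comp]
  simp

lemma diag_natural {X X' : V} {Y Y' : C} (f : X ⟶ X') (h : Y ⟶ Y') :
    (f ⊙ₗₘ h) ≫ diag X' Y' = diag X Y ≫ (f ⊙ₗₘ (f ⊙ₗₘ h)) := by
  rw [diag_comp_actionHom, diag, ← Category.assoc, ← MonoidalLeftAction.actionHom_id,
    ← MonoidalLeftAction.actionHom_comp]
  simp

lemma diag_comp_assoc_inv (X : V) (Y : C) :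
    diag X Y ≫ (αₗ X X Y).inv = lift (𝟙 X) (𝟙 X) ⊵ₗ Y := by
  simp [diag]

lemma diag_tensor (X X' : V) (Y : C) :
    diag (X ⊗ X') Y ≫ (fst X X' ⊙ₗₘ (snd X X' ⊙ₗₘ 𝟙 Y)) = (αₗ X X' Y).hom := by
  rw [diag_comp_actionHom]
  simp

/-- Both sides are the threefold diagonal of `X` acting on `Y`, in two bracketings that the pentagon
identifies. -/
lemma diag_coassoc (X : V) (Y : C) :
    diag X Y ≫ X ⊴ₗ diag X Y = diag X Y ≫ diag X (X ⊙ₗ Y) := by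
  have h₁ : diag X Y ≫ X ⊴ₗ diag X Y =
      (lift (𝟙 X) (lift (𝟙 X) (𝟙 X)) ⊵ₗ Y) ≫ (αₗ X (X ⊗ X) Y).hom ≫ X ⊴ₗ (αₗ X X Y).hom := by
    have := diag_comp_actionHom (𝟙 X) (lift (𝟙 X) (𝟙 X)) (𝟙 Y)
    simp only [MonoidalLeftAction.actionHom_id, MonoidalLeftAction.id_actionHom] at this
    conv_lhs => arg 2; rw [diag]
    rw [MonoidalLeftAction.actionHomRight_comp, reassoc_of% this]
  have h₂ : diag X Y ≫ diag X (X ⊙ₗ Y) =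
      (lift (lift (𝟙 X) (𝟙 X)) (𝟙 X) ⊵ₗ Y) ≫ (αₗ (X ⊗ X) X Y).hom ≫ (αₗ X X (X ⊙ₗ Y)).hom := by
    have := diag_comp_actionHom (lift (𝟙 X) (𝟙 X)) (𝟙 X) (𝟙 Y)
    simp only [MonoidalLeftAction.actionHom_id, MonoidalLeftAction.id_actionHomLeft] at this
    conv_lhs => arg 2; rw [diag]
    rw [reassoc_of% this]
  rw [h₁, h₂, ← MonoidalLeftAction.associator_actionHom,
    ← MonoidalLeftAction.comp_actionHomLeft_assoc]
  congr 3
  ext <;> simp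

lemma proj_natural {X X' : V} {Y Y' : C} (f : X ⟶ X') (h : Y ⟶ Y') :
    (f ⊙ₗₘ h) ≫ proj X' Y' = proj X Y ≫ h := by
  rw [proj, proj, Category.assoc, MonoidalLeftAction.actionUnitIso_hom_naturality,
    ← Category.assoc, ← Category.assoc, ← MonoidalLeftAction.actionHom_id,
    ← MonoidalLeftAction.actionHom_comp, ← MonoidalLeftAction.actionHom_def]
  simp

lemma diag_proj (X : V) (Y : C) : diag X Y ≫ proj X (X ⊙ₗ Y) = 𝟙 _ := by
  have := diag_comp_actionHom (toUnit X) (𝟙 X) (𝟙 Y)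
  simp only [MonoidalLeftAction.actionHom_id, MonoidalLeftAction.id_actionHomLeft] at this
  rw [proj, reassoc_of% this, ← MonoidalLeftAction.leftUnitor_actionHom,
    ← MonoidalLeftAction.comp_actionHomLeft, lift_leftUnitor_hom,
    MonoidalLeftAction.id_actionHomLeft]

lemma diag_actionHomRight_proj (X : V) (Y : C) : diag X Y ≫ X ⊴ₗ proj X Y = 𝟙 _ := by
  have := diag_comp_actionHom (𝟙 X) (toUnit X) (𝟙 Y)
  simp only [MonoidalLeftAction.actionHom_id, MonoidalLeftAction.id_actionHom] at this
  rw [proj, MonoidalLeftAction.actionHomRight_comp, reassoc_of% this,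
    ← MonoidalLeftAction.rightUnitor_actionHom,
    ← MonoidalLeftAction.comp_actionHomLeft, lift_rightUnitor_hom,
    MonoidalLeftAction.id_actionHomLeft]

lemma unit_inv_proj (Y : C) : (λₗ[V] Y).inv ≫ proj (𝟙_ V) Y = 𝟙 Y := by
  simp [proj]

lemma proj_unit_inv (X : V) (Y : C) : proj X Y ≫ (λₗ[V] Y).inv = toUnit X ⊵ₗ Y := by
  simp [proj]

end Diagonal

/-! ### Reindexing along the functors `X ⊙ₗ -` -/

section Reindex

variable {V : Type u₁} [Category.{v₁} V] [CartesianMonoidalCategory V]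
  {C : Type u₂} [Category.{v₂} C] [MonoidalLeftAction V C]
  [∀ X : V, PreservesFiniteCoproducts (MonoidalLeftAction.actionLeft C X)]

/-- The presheaf `D (X ⊙ₗ -)`. -/
def reindexL (X : V) (D : FP.{w} C) : FP.{w} C := reindex (MonoidalLeftAction.actionLeft C X) D

/-- Elements of `D` over `X ⊙ₗ Y`, as elements of `D (X ⊙ₗ -)` over `Y`. -/
def equivL {D : FP.{w} C} {X : V} {Y : C} : El D (X ⊙ₗ Y) ≃ El (reindexL X D) Y := Equiv.refl _

variable {D D' : FP.{w} C} {X X' : V} {Y Y' : C}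

@[simp] lemma equivL_res (g : Y' ⟶ Y) (x : El D (X ⊙ₗ Y)) :
    equivL (res (X ⊴ₗ g) x) = res g (equivL x) := rfl

@[simp] lemma equivL_symm_res (g : Y' ⟶ Y) (x : El (reindexL X D) Y) :
    equivL.symm (res g x) = res (X ⊴ₗ g) (equivL.symm x) := rfl

/-- Contravariance of `D (X ⊙ₗ -)` in `X`. -/
def reindexLMap (f : X' ⟶ X) (D : FP.{w} C) : reindexL X D ⟶ reindexL X' D :=
  FPhomMk (fun Z x => equivL (res (f ⊵ₗ Z) (equivL.symm x))) (fun g x => by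
    rw [equivL_symm_res, ← equivL_res, res_res, res_res, MonoidalLeftAction.action_exchange])

@[simp] lemma ap_reindexLMap (f : X' ⟶ X) (x : El (reindexL X D) Y) :
    ap (reindexLMap f D) x = equivL (res (f ⊵ₗ Y) (equivL.symm x)) := rfl

end Reindex

/-! ### The tensor product -/

section Tensor

variable {V : Type u₁} [Category.{v₁} V] [CartesianMonoidalCategory V]
  {C : Type u₂} [Category.{v₂} C] [HasFiniteCoproducts C] [MonoidalLeftAction V C]

/-- The copower of `B` by `P`: the presheaf that corepresents bilinear families. -/
def tens (P : FP.{max u₁ v₁ u₂ v₂} V) (B : FP.{max u₁ v₁ u₂ v₂} C) :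
    FP.{max u₁ v₁ u₂ v₂} C :=
  (exists_universal_bilin P B).choose

/-- The universal bilinear family. -/
def tensBilin (P : FP.{max u₁ v₁ u₂ v₂} V) (B : FP.{max u₁ v₁ u₂ v₂} C) :
    Bilin P B (tens P B) :=
  (exists_universal_bilin P B).choose_spec.choose

variable {P P' Q : FP.{max u₁ v₁ u₂ v₂} V} {B B' D : FP.{max u₁ v₁ u₂ v₂} C}
  {X X' : V} {Y Y' : C}

/-- Pure tensors. -/
def tmul (p : El P X) (b : El B Y) : El (tens P B) (X ⊙ₗ Y) := (tensBilin P B).app p b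

lemma tmul_res (f : X' ⟶ X) (g : Y' ⟶ Y) (p : El P X) (b : El B Y) :
    tmul (res f p) (res g b) = res (f ⊙ₗₘ g) (tmul p b) :=
  (tensBilin P B).app_res f g p b

lemma tmul_res_left (f : X' ⟶ X) (p : El P X) (b : El B Y) :
    tmul (res f p) b = res (f ⊵ₗ Y) (tmul p b) := by
  simpa using tmul_res f (𝟙 Y) p b

lemma tmul_res_right (g : Y' ⟶ Y) (p : El P X) (b : El B Y) :
    tmul p (res g b) = res (X ⊴ₗ g) (tmul p b) := by
  simpa using tmul_res (𝟙 X) g p b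

/-- The morphism induced by a bilinear family. -/
def tensDesc (β : Bilin P B D) : tens P B ⟶ D :=
  (((exists_universal_bilin P B).choose_spec.choose_spec D).2 β).choose

@[simp] lemma ap_tensDesc (β : Bilin P B D) (p : El P X) (b : El B Y) :
    ap (tensDesc β) (tmul p b) = β.app p b :=
  congrArg (fun γ : Bilin P B D => γ.app p b)
    (((exists_universal_bilin P B).choose_spec.choose_spec D).2 β).choose_spec

lemma tens_hom_ext {φ ψ : tens P B ⟶ D}
    (h : ∀ (X : V) (Y : C) (p : El P X) (b : El B Y), ap φ (tmul p b) = ap ψ (tmul p b)) :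
    φ = ψ := by
  refine ((exists_universal_bilin P B).choose_spec.choose_spec D).1 ?_
  ext X Y p b
  exact h X Y p b

/-- The functoriality of copowers. -/
def tensMap (f : P ⟶ P') (g : B ⟶ B') : tens P B ⟶ tens P' B' :=
  tensDesc
    { app p b := tmul (ap f p) (ap g b)
      app_res _ _ _ _ := by rw [ap_res, ap_res, tmul_res] }

@[simp] lemma ap_tensMap (f : P ⟶ P') (g : B ⟶ B') (p : El P X) (b : El B Y) :
    ap (tensMap f g) (tmul p b) = tmul (ap f p) (ap g b) := by
  simp [tensMap]

section Trilinear

variable [∀ X : V, PreservesFiniteCoproducts (MonoidalLeftAction.actionLeft C X)]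

/-- The morphism `B ⟶ D (X ⊙ₗ -)` obtained by fixing the first argument. -/
def tensCurry (χ : tens P B ⟶ D) (p : El P X) : B ⟶ reindexL X D :=
  FPhomMk (fun Z t => equivL (ap χ (tmul p t))) (fun f t => by
    rw [tmul_res_right, ap_res, equivL_res])

/-- An element of `tens Q B` need not be a pure tensor. Freezing `p` gives morphisms from `tens Q B`
to `D (X ⊙ₗ -)`, and these are determined by pure tensors. -/
lemma tens_hom_ext₂ {φ ψ : tens P (tens Q B) ⟶ D}
    (h : ∀ (X X' : V) (Y : C) (p : El P X) (q : El Q X') (b : El B Y),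
      ap φ (tmul p (tmul q b)) = ap ψ (tmul p (tmul q b))) : φ = ψ := by
  refine tens_hom_ext fun X Z p t => equivL.injective ?_
  have : tensCurry φ p = tensCurry ψ p :=
    tens_hom_ext fun X' Y q b => congrArg equivL (h X X' Y p q b)
  exact congrArg (fun χ => ap χ t) this

variable
  (app : ∀ {X X' : V} {Y : C}, El P X → El Q X' → El B Y → El D (X ⊙ₗ (X' ⊙ₗ Y)))
  (app_res : ∀ {X₁ X X₁' X' : V} {Y₁ Y : C} (f : X₁ ⟶ X) (f' : X₁' ⟶ X') (g : Y₁ ⟶ Y)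
    (p : El P X) (q : El Q X') (b : El B Y),
    app (res f p) (res f' q) (res g b) = res (f ⊙ₗₘ (f' ⊙ₗₘ g)) (app p q b))

/-- The partial application of a trilinear family. -/
def tensDesc₂Aux (p : El P X) : tens Q B ⟶ reindexL X D :=
  tensDesc
    { app q b := equivL (app p q b)
      app_res f g q b := by
        have := app_res (𝟙 X) f g p q b
        rw [res_id, MonoidalLeftAction.id_actionHom] at this
        rw [this, equivL_res] }

/-- Since `t` need not be a pure tensor, naturality in `p` is proved as an equality of morphisms out
of `tens Q B`. -/
lemma ap_tensDesc₂Aux_res (f : X' ⟶ X) (p : El P X) (t : El (tens Q B) Y) :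
    ap (tensDesc₂Aux app app_res (res f p)) t =
      equivL (res (f ⊵ₗ Y) (equivL.symm (ap (tensDesc₂Aux app app_res p) t))) := by
  have : tensDesc₂Aux app app_res (res f p) = tensDesc₂Aux app app_res p ≫ reindexLMap f D :=
    tens_hom_ext fun X₁ Y q b => by
      have := app_res f (𝟙 X₁) (𝟙 Y) p q b
      rw [res_id, res_id, MonoidalLeftAction.id_actionHom, MonoidalLeftAction.actionHomRight_id,
        MonoidalLeftAction.actionHom_id] at this
      simp only [tensDesc₂Aux, ap_tensDesc, ap_comp, ap_reindexLMap, Equiv.symm_apply_apply, this]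
  rw [this]
  rfl

/-- The morphism induced by a trilinear family. -/
def tensDesc₂ : tens P (tens Q B) ⟶ D :=
  tensDesc
    { app {X Z} p t := equivL.symm (ap (tensDesc₂Aux app app_res p) t)
      app_res {X X' Z Z'} f g p t := by
        rw [ap_tensDesc₂Aux_res, Equiv.symm_apply_apply, ap_res, equivL_symm_res, res_res,
          MonoidalLeftAction.actionHom_def] }

@[simp] lemma ap_tensDesc₂ (p : El P X) (q : El Q X') (b : El B Y) :
    ap (tensDesc₂ app app_res) (tmul p (tmul q b)) = app p q b := by
  simp [tensDesc₂, tensDesc₂Aux]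

end Trilinear

end Tensor

/-! ### The action on finite-product-preserving presheaves -/

section Action

variable {V : Type u₁} [Category.{v₁} V] [CartesianMonoidalCategory V] [HasFiniteCoproducts V]
  {C : Type u₂} [Category.{v₂} C] [HasFiniteCoproducts C] [MonoidalLeftAction V C]

variable {P P' Q Q' R : FP.{max u₁ v₁ u₂ v₂} V} {B B' D : FP.{max u₁ v₁ u₂ v₂} C}
  {X X' : V} {Y Y' : C}

lemma tens_tensor_hom_ext {φ ψ : tens (P ⊗ Q) B ⟶ D}
    (h : ∀ (X : V) (Y : C) (p : El P X) (q : El Q X) (b : El B Y),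
      ap φ (tmul (pairEl p q) b) = ap ψ (tmul (pairEl p q) b)) : φ = ψ :=
  tens_hom_ext fun X Y x b => by
    obtain ⟨p, q, rfl⟩ := exists_pairEl x
    exact h X Y p q b

/-- The comparison `(P × Q) ⊙ₗ B ⟶ P ⊙ₗ (Q ⊙ₗ B)`. -/
def tensAssocHom (P Q : FP.{max u₁ v₁ u₂ v₂} V) (B : FP.{max u₁ v₁ u₂ v₂} C) :
    tens (P ⊗ Q) B ⟶ tens P (tens Q B) :=
  tensDesc
    -- Both components of `x` live over the same `X`, so the nested tensor lives over `X ⊙ₗ (X ⊙ₗ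
    -- Y)` and is pulled back along the diagonal.
    { app {X Y} x b := res (diag X Y) (tmul (ap (fst P Q) x) (tmul (ap (snd P Q) x) b))
      app_res f g x b := by
        rw [ap_res, ap_res, tmul_res, tmul_res, res_res, res_res, diag_natural] }

@[simp] lemma ap_tensAssocHom (p : El P X) (q : El Q X) (b : El B Y) :
    ap (tensAssocHom P Q B) (tmul (pairEl p q) b) = res (diag X Y) (tmul p (tmul q b)) := by
  simp [tensAssocHom]

/-- The comparison `1 ⊙ₗ B ⟶ B`. -/
def tensUnitHom (B : FP.{max u₁ v₁ u₂ v₂} C) : tens (𝟙_ (FP.{max u₁ v₁ u₂ v₂} V)) B ⟶ B :=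
  tensDesc
    { app {X Y} _ b := res (proj X Y) b
      app_res f g _ b := by rw [res_res, res_res, proj_natural] }

@[simp] lemma ap_tensUnitHom (x : El (𝟙_ (FP.{max u₁ v₁ u₂ v₂} V)) X) (b : El B Y) :
    ap (tensUnitHom B) (tmul x b) = res (proj X Y) b := by
  simp [tensUnitHom]

/-- The unit isomorphism `1 ⊙ₗ B ≅ B`. -/
def tensUnitIso (B : FP.{max u₁ v₁ u₂ v₂} C) :
    tens (𝟙_ (FP.{max u₁ v₁ u₂ v₂} V)) B ≅ B where
  hom := tensUnitHom B
  inv := FPhomMk (fun Y b => res (λₗ[V] Y).inv (tmul (unitEl (𝟙_ V)) b)) (fun f b => by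
    rw [tmul_res_right, res_res, res_res, MonoidalLeftAction.actionUnitIso_inv_naturality])
  hom_inv_id := tens_hom_ext fun X Y x b => by
    simp only [ap_comp, ap_tensUnitHom, ap_FPhomMk, ap_id]
    rw [tmul_res_right, res_res, MonoidalLeftAction.actionUnitIso_inv_naturality, proj_unit_inv,
      ← tmul_res_left, eq_unitEl x, res_unitEl]
  inv_hom_id := FP_hom_ext fun Y b => by
    simp only [ap_comp, ap_tensUnitHom, ap_FPhomMk, ap_id, ap_res, res_res, unit_inv_proj, res_id]

variable [∀ X : V, PreservesFiniteCoproducts (MonoidalLeftAction.actionLeft C X)]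

/-- The associativity isomorphism `(P × Q) ⊙ₗ B ≅ P ⊙ₗ (Q ⊙ₗ B)`. -/
def tensAssocIso (P Q : FP.{max u₁ v₁ u₂ v₂} V) (B : FP.{max u₁ v₁ u₂ v₂} C) :
    tens (P ⊗ Q) B ≅ tens P (tens Q B) where
  hom := tensAssocHom P Q B
  inv := tensDesc₂
    -- Here `p` and `q` live over different objects; the projections bring both over `X ⊗ X'`.
    (fun {X X' Y} p q b => res (αₗ X X' Y).inv
      (tmul (pairEl (res (fst X X') p) (res (snd X X') q)) b))
    (fun f f' g p q b => by
      have h := tmul_res (f ⊗ₘ f') g (pairEl (res (fst _ _) p) (res (snd _ _) q)) b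
      simp only [res_pairEl, res_res, tensorHom_fst, tensorHom_snd] at h
      rw [res_res, res_res, h, res_res, res_res,
        MonoidalLeftAction.actionAssocIso_inv_naturality])
  hom_inv_id := tens_tensor_hom_ext fun X Y p q b => by
    simp only [ap_comp, ap_tensAssocHom, ap_res, ap_tensDesc₂, ap_id, res_res,
      diag_comp_assoc_inv]
    rw [← tmul_res_left, res_pairEl, res_res, res_res, lift_fst, lift_snd, res_id, res_id]
  inv_hom_id := tens_hom_ext₂ fun X X' Y p q b => by
    simp only [ap_comp, ap_tensAssocHom, ap_res, ap_tensDesc₂, ap_id, res_res]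
    rw [tmul_res_left _ q, tmul_res, res_res, Category.assoc, ← MonoidalLeftAction.actionHom_id,
      diag_tensor, Iso.inv_hom_id, res_id]

/-- The action of presheaves on `V` on presheaves on `C`. -/
instance tensAction : MonoidalLeftAction (FP.{max u₁ v₁ u₂ v₂} V) (FP.{max u₁ v₁ u₂ v₂} C) where
  actionObj := tens
  actionHomLeft f B := tensMap f (𝟙 B)
  actionHomRight P _ _ g := tensMap (𝟙 P) g
  actionHom f g := tensMap f g
  actionAssocIso := tensAssocIso
  actionUnitIso := tensUnitIso
  actionHom_def f g := tens_hom_ext fun X Y p b => by simp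
  actionHomRight_id P B := tens_hom_ext fun X Y p b => by simp
  id_actionHomLeft P B := tens_hom_ext fun X Y p b => by simp
  actionHom_comp f₁ f₂ g₁ g₂ := tens_hom_ext fun X Y p b => by simp
  actionAssocIso_hom_naturality f g h := tens_tensor_hom_ext fun X Y p q b => by
    simp [tensAssocIso]
  actionUnitIso_hom_naturality f := tens_hom_ext fun X Y p b => by simp [tensUnitIso]
  whiskerLeft_actionHomLeft P {Q Q'} f B := by
    rw [← Category.assoc, Iso.eq_comp_inv]
    exact tens_tensor_hom_ext fun X Y p q b => by simp [tensAssocIso]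
  whiskerRight_actionHomLeft {P P'} Q f B := by
    rw [← Category.assoc, Iso.eq_comp_inv]
    exact tens_tensor_hom_ext fun X Y p q b => by simp [tensAssocIso]
  associator_actionHom P Q R B := tens_tensor_hom_ext fun X Y x r b => by
    obtain ⟨p, q, rfl⟩ := exists_pairEl x
    simp [tensAssocIso, tmul_res_right, diag_coassoc]
  leftUnitor_actionHom P B := tens_tensor_hom_ext fun X Y x p b => by
    rw [eq_unitEl x]
    simp [tensAssocIso, tensUnitIso, diag_proj]
  rightUnitor_actionHom P B := tens_tensor_hom_ext fun X Y p x b => by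
    rw [eq_unitEl x]
    simp [tensAssocIso, tensUnitIso, tmul_res_right, diag_actionHomRight_proj]

end Action

/-! ### Right adjoints -/

section Hom

variable {A : Type u₁} [Category.{v₁} A] {A' : Type u₂} [Category.{v₂} A']
  {A'' : Type u₃} [Category.{v₃} A''] (T : A ⥤ A' ⥤ A'')

/-- Families of elements that are natural in two variables. -/
structure BiFamily (P : FP.{max u₂ w} A) (B : FP.{max u₂ w} A') (D : FP.{max u₂ w} A'') where
  /-- The value at a pair of elements. -/
  app {X : A} {Y : A'} : El P X → El B Y → El D ((T.obj X).obj Y)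
  app_res_left {X' X : A} {Y : A'} (f : X' ⟶ X) (p : El P X) (b : El B Y) :
    app (res f p) b = res ((T.map f).app Y) (app p b)
  app_res_right {X : A} {Y' Y : A'} (g : Y' ⟶ Y) (p : El P X) (b : El B Y) :
    app p (res g b) = res ((T.obj X).map g) (app p b)

variable {T} in
lemma BiFamily.hom_ext {P : FP.{max u₂ w} A} {B : FP.{max u₂ w} A'} {D : FP.{max u₂ w} A''}
    {β γ : BiFamily.{w} T P B D}
    (h : ∀ (X : A) (Y : A') (p : El P X) (b : El B Y), β.app p b = γ.app p b) : β = γ := by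
  obtain ⟨app, _, _⟩ := β
  obtain ⟨app', _, _⟩ := γ
  obtain rfl : @app = @app' := by
    funext X Y p b
    exact h X Y p b
  rfl

variable [∀ X, PreservesFiniteCoproducts (T.obj X)]

/-- The functor `X ↦ D (T X -)`. -/
def reindexFunctor (D : FP.{w} A'') : Aᵒᵖ ⥤ FP.{w} A' where
  obj X := reindex (T.obj X.unop) D
  map f := ObjectProperty.homMk (Functor.whiskerRight (NatTrans.op (T.map f.unop)) D.obj)

/-- Products in `FP` can be tested in presheaves, pointwise; at `Y` the functor is `D (T - Y)`. -/
instance [∀ Y, PreservesFiniteCoproducts (T.flip.obj Y)] (D : FP.{w} A'') :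
    PreservesFiniteProducts (reindexFunctor T D) where
  preserves n := by
    have := D.property
    have : PreservesLimitsOfShape (Discrete (Fin n)) (reindexFunctor T D ⋙ ObjectProperty.ι _) :=
      preservesLimitsOfShape_of_evaluation _ _ fun Y => by
        have := preservesFiniteProducts_op (T.flip.obj Y.unop)
        change PreservesLimitsOfShape _ ((T.flip.obj Y.unop).op ⋙ D.obj)
        infer_instance
    exact preservesLimitsOfShape_of_reflects_of_preserves _
      (ObjectProperty.ι (fun P : A'ᵒᵖ ⥤ Type w => PreservesFiniteProducts P))

variable [∀ Y, PreservesFiniteCoproducts (T.flip.obj Y)]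

/-- The presheaf of morphisms `X ↦ Hom (B, D (T X -))`. -/
def homFP (B : FP.{max u₂ w} A') (D : FP.{max u₂ w} A'') : FP.{max u₂ w} A where
  obj := reindexFunctor T D ⋙ coyoneda.obj (op B)
  property := inferInstance

variable {T} {B : FP.{max u₂ w} A'} {D : FP.{max u₂ w} A''} {X X' : A} {Y : A'}

/-- Evaluation of an element of `homFP T B D`. -/
def evalEl (x : El (homFP.{w} T B D) X) (b : El B Y) : El D ((T.obj X).obj Y) :=
  ap (Q := reindex (T.obj X) D) x b

lemma evalEl_res_left (f : X' ⟶ X) (x : El (homFP.{w} T B D) X) (b : El B Y) :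
    evalEl (res f x) b = res ((T.map f).app Y) (evalEl x b) := rfl

lemma evalEl_res_right {Y' : A'} (g : Y' ⟶ Y) (x : El (homFP.{w} T B D) X) (b : El B Y) :
    evalEl x (res g b) = res ((T.obj X).map g) (evalEl x b) :=
  ap_res (Q := reindex (T.obj X) D) x g b

lemma evalEl_ext {x y : El (homFP.{w} T B D) X}
    (h : ∀ (Y : A') (b : El B Y), evalEl x b = evalEl y b) : x = y :=
  FP_hom_ext (Q := reindex (T.obj X) D) h

/-- Construction of elements of `homFP T B D`. -/
def mkEl (app : ∀ Y, El B Y → El D ((T.obj X).obj Y))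
    (h : ∀ {Y' Y : A'} (g : Y' ⟶ Y) (b : El B Y),
      app Y' (res g b) = res ((T.obj X).map g) (app Y b)) : El (homFP.{w} T B D) X :=
  FPhomMk (Q := reindex (T.obj X) D) app h

@[simp] lemma evalEl_mkEl (app : ∀ Y, El B Y → El D ((T.obj X).obj Y))
    (h : ∀ {Y' Y : A'} (g : Y' ⟶ Y) (b : El B Y),
      app Y' (res g b) = res ((T.obj X).map g) (app Y b)) (b : El B Y) :
    evalEl (mkEl.{w} (T := T) app h) b = app Y b := rfl

/-- Morphisms to `homFP T B D` are families of elements of `D`. -/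
def homFPEquiv {P : FP.{max u₂ w} A} : BiFamily.{w} T P B D ≃ (P ⟶ homFP.{w} T B D) where
  toFun β := FPhomMk (fun X p => mkEl (fun Y b => β.app p b) (fun g b => β.app_res_right g p b))
    (fun f p => evalEl_ext fun Y b => by
      rw [evalEl_mkEl, evalEl_res_left, evalEl_mkEl, β.app_res_left])
  invFun φ :=
    { app p b := evalEl (ap φ p) b
      app_res_left f p b := by rw [ap_res, evalEl_res_left]
      app_res_right g p b := evalEl_res_right g (ap φ p) b }
  left_inv β := rfl
  right_inv φ := rfl

/-- An elementwise criterion for the naturality that `Adjunction.adjunctionOfEquivRight` requires.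
-/
lemma homFPEquiv_comp {P P' : FP.{max u₂ w} A} (f : P' ⟶ P) (β : BiFamily.{w} T P B D)
    (β' : BiFamily.{w} T P' B D)
    (h : ∀ (X : A) (Y : A') (p : El P' X) (b : El B Y), β'.app p b = β.app (ap f p) b) :
    homFPEquiv β' = f ≫ homFPEquiv β :=
  FP_hom_ext fun X p => evalEl_ext fun Y b => h X Y p b

end Hom

section Adjoints

variable {V : Type u₁} [Category.{v₁} V] [CartesianMonoidalCategory V]
  {C : Type u₂} [Category.{v₂} C] [HasFiniteCoproducts C] [MonoidalLeftAction V C]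

/-- Morphisms out of a copower are families natural in two variables. -/
def tensEquiv (P : FP.{max u₁ v₁ u₂ v₂} V) (B D : FP.{max u₁ v₁ u₂ v₂} C) :
    (tens P B ⟶ D) ≃ BiFamily.{max u₁ v₁ u₂ v₂} (MonoidalLeftAction.curriedAction V C) P B D where
  toFun χ :=
    { app p b := ap χ (tmul p b)
      app_res_left f p b := (congrArg (ap χ) (tmul_res_left f p b)).trans (ap_res χ _ _)
      app_res_right g p b := (congrArg (ap χ) (tmul_res_right g p b)).trans (ap_res χ _ _) }
  invFun β := tensDesc
    { app p b := β.app p b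
      app_res f g p b := by
        refine (β.app_res_left f p (res g b)).trans
          ((congrArg _ (β.app_res_right g p b)).trans ((res_res _ _ _).trans ?_))
        exact congrArg (fun h => res (P := D) h (β.app p b))
          (MonoidalLeftAction.actionHom_def f g).symm }
  left_inv χ := tens_hom_ext fun X Y p b => ap_tensDesc _ p b
  right_inv _ := BiFamily.hom_ext fun _ _ p b => ap_tensDesc _ p b

variable [∀ X : V, PreservesFiniteCoproducts (MonoidalLeftAction.actionLeft C X)]
  [∀ Y : C, PreservesFiniteCoproducts (MonoidalLeftAction.actionRight V Y)]

instance (X : V) :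
    PreservesFiniteCoproducts ((MonoidalLeftAction.curriedAction V C).obj X) :=
  inferInstanceAs (PreservesFiniteCoproducts (MonoidalLeftAction.actionLeft C X))

instance (Y : C) :
    PreservesFiniteCoproducts ((MonoidalLeftAction.curriedAction V C).flip.obj Y) :=
  inferInstanceAs (PreservesFiniteCoproducts (MonoidalLeftAction.actionRight V Y))

instance (X : V) :
    PreservesFiniteCoproducts ((MonoidalLeftAction.curriedAction V C).flip.flip.obj X) :=
  inferInstanceAs (PreservesFiniteCoproducts (MonoidalLeftAction.actionLeft C X))

variable [HasFiniteCoproducts V]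

/-- Exchanging the two variables of a family. -/
def BiFamily.flipEquiv (P : FP.{max u₁ v₁ u₂ v₂} V) (B D : FP.{max u₁ v₁ u₂ v₂} C) :
    BiFamily.{max u₁ v₁ u₂ v₂} (MonoidalLeftAction.curriedAction V C) P B D ≃
      BiFamily.{max u₁ v₁ u₂ v₂} (MonoidalLeftAction.curriedAction V C).flip B P D where
  toFun β := ⟨fun b p => β.app p b, fun g b p => β.app_res_right g p b,
    fun f b p => β.app_res_left f p b⟩
  invFun β := ⟨fun p b => β.app b p, fun g b p => β.app_res_right g p b,
    fun f b p => β.app_res_left f p b⟩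
  left_inv _ := rfl
  right_inv _ := rfl

lemma isLeftAdjoint_actionRight_FP (B : FP.{max u₁ v₁ u₂ v₂} C) :
    (MonoidalLeftAction.actionRight (FP.{max u₁ v₁ u₂ v₂} V) B).IsLeftAdjoint :=
  (Adjunction.adjunctionOfEquivRight
    (F := MonoidalLeftAction.actionRight (FP.{max u₁ v₁ u₂ v₂} V) B)
    (G_obj := fun D =>
      homFP.{max u₁ v₁ u₂ v₂} (MonoidalLeftAction.curriedAction V C) B D)
    (fun P D => (tensEquiv P B D).trans homFPEquiv) (fun P P' D f χ =>
      homFPEquiv_comp f (tensEquiv P' B D χ) (tensEquiv P B D (tensMap f (𝟙 B) ≫ χ))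
        fun _ _ p b => congrArg (ap χ) (ap_tensMap f (𝟙 B) p b))).isLeftAdjoint

lemma isLeftAdjoint_actionLeft_FP (P : FP.{max u₁ v₁ u₂ v₂} V) :
    (MonoidalLeftAction.actionLeft (FP.{max u₁ v₁ u₂ v₂} C) P).IsLeftAdjoint :=
  (Adjunction.adjunctionOfEquivRight
    (F := MonoidalLeftAction.actionLeft (FP.{max u₁ v₁ u₂ v₂} C) P)
    (G_obj := fun D =>
      homFP.{max u₁ v₁ u₂ v₂} (MonoidalLeftAction.curriedAction V C).flip P D)
    (fun B D => ((tensEquiv P B D).trans (BiFamily.flipEquiv P B D)).trans homFPEquiv)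
    (fun B B' D f χ =>
      homFPEquiv_comp f (BiFamily.flipEquiv P B' D (tensEquiv P B' D χ))
        (BiFamily.flipEquiv P B D (tensEquiv P B D (tensMap (𝟙 P) f ≫ χ)))
        fun _ _ b p => congrArg (ap χ) (ap_tensMap (𝟙 P) f p b))).isLeftAdjoint

end Adjoints

/-! ### Cartesian closure -/

section Closed

variable {V : Type u₁} [Category.{v₁} V] [CartesianMonoidalCategory V] [HasFiniteCoproducts V]

/-- Morphisms out of a product are families natural in two variables. -/
def prodEquiv (Q P D : FP.{max u₁ w} V) :
    (Q ⊗ P ⟶ D) ≃ BiFamily.{w} (curriedTensor V).flip P Q D where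
  toFun χ :=
    -- The projections bring `q` and `p` together over `Y ⊗ X`; the inverse restricts along the
    -- diagonal.
    { app {X Y} p q := ap χ (pairEl (res (fst Y X) q) (res (snd Y X) p))
      app_res_left f p q := by
        refine Eq.trans ?_ (ap_res χ _ _)
        rw [res_pairEl, res_res, res_res, res_res]
        simp
      app_res_right g p q := by
        refine Eq.trans ?_ (ap_res χ _ _)
        rw [res_pairEl, res_res, res_res, res_res]
        simp }
  invFun β := FPhomMk (fun X x => res (P := D) (lift (𝟙 X) (𝟙 X))
      (β.app (ap (snd Q P) x) (ap (fst Q P) x)))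
    (fun {X Y} f x => by
      rw [ap_res, ap_res, β.app_res_left, β.app_res_right, res_res, res_res, res_res]
      have : (lift (𝟙 X) (𝟙 X) ≫ (X ◁ f)) ≫ (f ▷ Y) = f ≫ lift (𝟙 Y) (𝟙 Y) := by
        ext <;> simp
      exact congrArg (fun g => res (P := D) g _) this)
  left_inv χ := FP_hom_ext fun X x => by
    obtain ⟨q, p, rfl⟩ := exists_pairEl x
    rw [ap_FPhomMk, ap_fst, ap_snd]
    refine (ap_res χ _ _).symm.trans ?_
    rw [res_pairEl, res_res, res_res]
    simp
  right_inv β := BiFamily.hom_ext fun X Y p q => by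
    dsimp only
    rw [ap_FPhomMk, ap_fst, ap_snd, β.app_res_left, β.app_res_right, res_res, res_res]
    have : (lift (𝟙 (Y ⊗ X)) (𝟙 (Y ⊗ X)) ≫ ((Y ⊗ X) ◁ snd Y X)) ≫ (fst Y X ▷ X) = 𝟙 _ := by
      ext <;> simp
    exact (congrArg (fun g => res (P := D) g (β.app p q)) this).trans
      (res_id _)

variable [∀ X : V, PreservesFiniteCoproducts (tensorLeft X)]

instance (X : V) : PreservesFiniteCoproducts ((curriedTensor V).flip.flip.obj X) :=
  inferInstanceAs (PreservesFiniteCoproducts (tensorLeft X))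

instance (X : V) : PreservesFiniteCoproducts ((curriedTensor V).flip.obj X) :=
  letI := BraidedCategory.ofCartesianMonoidalCategory (C := V)
  ⟨fun _ => preservesColimitsOfShape_of_natIso (BraidedCategory.tensorLeftIsoTensorRight X)⟩

lemma nonempty_monoidalClosed_FP : Nonempty (MonoidalClosed (FP.{max u₁ w} V)) :=
  ⟨{ closed Q :=
      { rightAdj := _
        adj := Adjunction.adjunctionOfEquivRight (F := tensorLeft Q)
          (G_obj := fun D => homFP.{w} (curriedTensor V).flip Q D)
          (fun P D => (prodEquiv.{w} Q P D).trans homFPEquiv) (fun P P' D f χ =>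
            homFPEquiv_comp f (prodEquiv Q P' D χ) (prodEquiv Q P D (Q ◁ f ≫ χ))
              fun X Y p q => congrArg (fun p => ap χ (pairEl (res (fst Y X) q) p))
                (ap_res f (snd Y X) p)) } }⟩

end Closed

/-! ### Distributive enriched models -/

lemma preservesFiniteCoproducts_of_isIso {A : Type u₁} [Category.{v₁} A] [HasFiniteCoproducts A]
    {A' : Type u₂} [Category.{v₂} A'] [HasFiniteCoproducts A'] (F : A ⥤ A')
    (h : IsIso (initial.to (F.obj (⊥_ A))))
    (h' : ∀ X Y : A, IsIso (coprodComparison F X Y)) : PreservesFiniteCoproducts F := by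
  have := preservesInitial_of_isIso F (initial.to (F.obj (⊥_ A)))
  have := preservesColimitsOfShape_pempty_of_preservesInitial F
  have := preservesBinaryCoproducts_of_isIso_coprodComparison F
  exact ⟨fun n => PreservesFiniteCoproducts.of_preserves_binary_and_initial F (Fin n)⟩

section Model

variable (V : Type u₁) [Category.{v₁} V] [CartesianMonoidalCategory V] [HasFiniteCoproducts V]
  (C : Type u₂) [Category.{v₂} C] [HasFiniteCoproducts C] [MonoidalLeftAction V C]

/-- This is where distributivity of the action enters; in the other variable preservation comes from
the right adjoint of `- ⊙ₗ Y`. -/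
instance [IsDistributiveEnrichedModel V C] (X : V) :
    PreservesFiniteCoproducts (MonoidalLeftAction.actionLeft C X) :=
  preservesFiniteCoproducts_of_isIso _ (IsDistributiveEnrichedModel.isIso_action_initial X)
    (IsDistributiveEnrichedModel.isIso_action_coprod X)

instance (Y : C) [IsEnrichedModel V C] :
    PreservesFiniteCoproducts (MonoidalLeftAction.actionRight V Y) :=
  ⟨fun _ => inferInstance⟩

instance [IsDistributiveCategory V] (X : V) : PreservesFiniteCoproducts (tensorLeft X) :=
  preservesFiniteCoproducts_of_isIso _ (IsDistributiveCategory.isIso_initial X)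
    (IsDistributiveCategory.isIso_coprod X)

instance isClosedEnrichedModel_FP [IsDistributiveEnrichedModel V C] :
    IsClosedEnrichedModel (FP.{max u₁ v₁ u₂ v₂} V) (FP.{max u₁ v₁ u₂ v₂} C) where
  isLeftAdjoint_actionRight := isLeftAdjoint_actionRight_FP
  cartesianClosed := nonempty_monoidalClosed_FP.{max v₁ u₂ v₂}
  hasFiniteCoproducts_values := hasFiniteCoproducts_FP.{max u₂ v₂}
  hasPowers := isLeftAdjoint_actionLeft_FP
  hasFiniteProducts := inferInstance
  hasFiniteCoproducts := hasFiniteCoproducts_FP.{max u₁ v₁}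

end Model

/-! ### The Yoneda embedding of a distributive enriched model -/

instance preservesFiniteProducts_yonedaFP {A : Type u} [Category.{v} A] :
    PreservesFiniteProducts (yonedaFP.{w} A) where
  preserves n := by
    have : PreservesLimitsOfShape (Discrete (Fin n)) (yonedaFP.{w} A ⋙
        ObjectProperty.ι (fun P : Aᵒᵖ ⥤ Type (max w v) => PreservesFiniteProducts P)) :=
      inferInstanceAs (PreservesLimitsOfShape (Discrete (Fin n)) uliftYoneda.{w})
    exact preservesLimitsOfShape_of_reflects_of_preserves (yonedaFP.{w} A)
      (ObjectProperty.ι (fun P : Aᵒᵖ ⥤ Type (max w v) => PreservesFiniteProducts P))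

section Lam

variable {V : Type u₁} [Category.{v₁} V] [CartesianMonoidalCategory V]
  {C : Type u₂} [Category.{v₂} C] [HasFiniteCoproducts C] [MonoidalLeftAction V C]

/-- The Yoneda embeddings preserve copowers. -/
def yonedaLam (X : V) (Y : C) :
    (yonedaFP.{max u₁ v₁ u₂} C).obj (X ⊙ₗ Y) ≅
      tens ((yonedaFP.{max u₁ u₂ v₂} V).obj X) ((yonedaFP.{max u₁ v₁ u₂} C).obj Y) where
  hom := ydesc (tmul (yel (𝟙 X)) (yel (𝟙 Y)))
  inv := tensDesc
    { app f g := yel (f.down ⊙ₗₘ g.down)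
      app_res f g p b := by
        obtain ⟨p, rfl⟩ := yel_surjective p
        obtain ⟨b, rfl⟩ := yel_surjective b
        exact congrArg yel (MonoidalLeftAction.actionHom_comp _ _ _ _) }
  hom_inv_id := yoneda_hom_ext (by
    rw [ap_comp, ap_ydesc, ap_res, ap_tensDesc, res_id]
    exact congrArg yel (by simp [yel]))
  inv_hom_id := tens_hom_ext fun X' Y' p b => by
    obtain ⟨p, rfl⟩ := yel_surjective p
    obtain ⟨b, rfl⟩ := yel_surjective b
    rw [ap_comp, ap_tensDesc, ap_ydesc, ← tmul_res]
    change tmul (res p (yel _)) (res b (yel _)) = _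
    simp

@[simp] lemma ap_yonedaLam_hom {X : V} {Y Z : C} (f : Z ⟶ X ⊙ₗ Y) :
    ap (yonedaLam X Y).hom (yel f) = res f (tmul (yel (𝟙 X)) (yel (𝟙 Y))) := rfl

lemma yonedaLam_naturality {X X' : V} {Y Y' : C} (f : X ⟶ X') (g : Y ⟶ Y') :
    (yonedaFP.{max u₁ v₁ u₂} C).map (f ⊙ₗₘ g) ≫ (yonedaLam X' Y').hom =
      (yonedaLam X Y).hom ≫ tensMap ((yonedaFP.{max u₁ u₂ v₂} V).map f)
        ((yonedaFP.{max u₁ v₁ u₂} C).map g) :=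
  yoneda_hom_ext (by simp [← tmul_res])

variable [HasFiniteCoproducts V]

lemma yonedaLam_unit (Y : C) :
    (yonedaLam (𝟙_ V) Y).hom ≫ tensMap (toUnit _) (𝟙 _) ≫ (tensUnitIso _).hom =
      (yonedaFP.{max u₁ v₁ u₂} C).map (λₗ[V] Y).hom :=
  yoneda_hom_ext (by
    have : toUnit (𝟙_ V) = 𝟙 _ := by ext
    simp [tensUnitIso, proj, this])

lemma yonedaLam_assoc [∀ X : V, PreservesFiniteCoproducts (MonoidalLeftAction.actionLeft C X)]
    (X X' : V) (Y : C) :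
    (yonedaFP.{max u₁ v₁ u₂} C).map (αₗ X X' Y).hom ≫ (yonedaLam X (X' ⊙ₗ Y)).hom ≫
        tensMap (𝟙 _) (yonedaLam X' Y).hom =
      (yonedaLam (X ⊗ X') Y).hom ≫
        tensMap (lift ((yonedaFP.{max u₁ u₂ v₂} V).map (fst X X'))
          ((yonedaFP.{max u₁ u₂ v₂} V).map (snd X X'))) (𝟙 _) ≫ (tensAssocIso _ _ _).hom :=
  yoneda_hom_ext (by
    -- The identity of `X ⊗ X'` becomes the pair of projections; `h` pulls these out of the tensor,
    -- and `diag_tensor` turns diagonal and projections into the associator.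
    have h := tmul_res (fst X X') (snd X X' ⊙ₗₘ 𝟙 Y) (yel.{max u₁ u₂ v₂} (𝟙 X))
      (tmul (yel.{max u₁ u₂ v₂} (𝟙 X')) (yel.{max u₁ v₁ u₂} (𝟙 Y)))
    rw [← tmul_res, res_id] at h
    simp only [res_yel, Category.comp_id] at h
    simp [tensAssocIso, h, ← diag_tensor])

end Lam

/-! ### Comparison of enriched homs -/

section Embedding

variable (V : Type u₁) [Category.{v₁} V] [CartesianMonoidalCategory V] [HasFiniteCoproducts V]
  (C : Type u₂) [Category.{v₂} C] [HasFiniteCoproducts C] [MonoidalLeftAction V C]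
  [IsDistributiveEnrichedModel V C]

/-- A composite of bijections: transpose in `(V, C)`, full faithfulness of `y`, precomposition with
an isomorphism, transpose in `FP`. -/
lemma bijective_enrichedHomEquiv_yonedaLam (X : V) (B D : C) : Function.Bijective
    (fun f : X ⟶ enrichedHom V B D =>
      enrichedHomEquiv (FP.{max u₁ v₁ u₂ v₂} V) ((yonedaFP.{max u₁ u₂ v₂} V).obj X)
        ((yonedaFP.{max u₁ v₁ u₂} C).obj B) ((yonedaFP.{max u₁ v₁ u₂} C).obj D)
        ((yonedaLam X B).inv ≫ (yonedaFP.{max u₁ v₁ u₂} C).map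
          ((enrichedHomEquiv V X B D).symm f))) :=
  ((enrichedHomEquiv V X B D).symm.trans
    (((Functor.FullyFaithful.ofFullyFaithful (yonedaFP.{max u₁ v₁ u₂} C)).homEquiv).trans
      ((yonedaLam X B).homFromEquiv.trans (enrichedHomEquiv (FP.{max u₁ v₁ u₂ v₂} V)
        ((yonedaFP.{max u₁ u₂ v₂} V).obj X) ((yonedaFP.{max u₁ v₁ u₂} C).obj B)
        ((yonedaFP.{max u₁ v₁ u₂} C).obj D))))).bijective

variable {V C} in
-- Identifies the preceding bijection with composition with the mate, by naturality of transposition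
-- and of `yonedaLam`.
lemma yonedaFP_map_comp_mate {X : V} {B D : C} (f : X ⟶ enrichedHom V B D) :
    (yonedaFP.{max u₁ u₂ v₂} V).map f ≫
      enrichedHomEquiv (FP.{max u₁ v₁ u₂ v₂} V)
        ((yonedaFP.{max u₁ u₂ v₂} V).obj (enrichedHom V B D))
        ((yonedaFP.{max u₁ v₁ u₂} C).obj B) ((yonedaFP.{max u₁ v₁ u₂} C).obj D)
        ((yonedaLam (enrichedHom V B D) B).inv ≫
          (yonedaFP.{max u₁ v₁ u₂} C).map (enrichedEv V B D)) =
      enrichedHomEquiv (FP.{max u₁ v₁ u₂ v₂} V) ((yonedaFP.{max u₁ u₂ v₂} V).obj X)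
        ((yonedaFP.{max u₁ v₁ u₂} C).obj B) ((yonedaFP.{max u₁ v₁ u₂} C).obj D)
        ((yonedaLam X B).inv ≫ (yonedaFP.{max u₁ v₁ u₂} C).map
          ((enrichedHomEquiv V X B D).symm f)) := by
  refine ((Adjunction.homEquiv_naturality_left _ _ _).symm.trans ?_)
  refine congrArg (enrichedHomEquiv (FP.{max u₁ v₁ u₂ v₂} V) ((yonedaFP.{max u₁ u₂ v₂} V).obj X)
    ((yonedaFP.{max u₁ v₁ u₂} C).obj B) ((yonedaFP.{max u₁ v₁ u₂} C).obj D)) ?_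
  have h₁ : (enrichedHomEquiv V X B D).symm f = (f ⊙ₗₘ 𝟙 B) ≫ enrichedEv V B D := by
    rw [MonoidalLeftAction.actionHom_id]
    exact (Adjunction.ofIsLeftAdjoint (MonoidalLeftAction.actionRight V B)).homEquiv_counit _ _ _
  have h₂ := yonedaLam_naturality f (𝟙 B)
  rw [CategoryTheory.Functor.map_id] at h₂
  have h₃ : tensMap ((yonedaFP.{max u₁ u₂ v₂} V).map f) (𝟙 _) ≫
      (yonedaLam (enrichedHom V B D) B).inv =
        (yonedaLam X B).inv ≫ (yonedaFP.{max u₁ v₁ u₂} C).map (f ⊙ₗₘ 𝟙 B) := by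
    rw [Iso.eq_inv_comp, ← Category.assoc, Iso.comp_inv_eq, h₂]
  rw [h₁, CategoryTheory.Functor.map_comp]
  exact (Category.assoc _ _ _).symm.trans
    ((congrArg (· ≫ _) h₃).trans (Category.assoc _ _ _))

/-- Elements over `X` are morphisms out of `y X`, so bijectivity on elements is the bijection just
described. -/
lemma isIso_mate_yonedaLam (B D : C) :
    IsIso (enrichedHomEquiv (FP.{max u₁ v₁ u₂ v₂} V)
      ((yonedaFP.{max u₁ u₂ v₂} V).obj (enrichedHom V B D))
      ((yonedaFP.{max u₁ v₁ u₂} C).obj B) ((yonedaFP.{max u₁ v₁ u₂} C).obj D)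
      ((yonedaLam (enrichedHom V B D) B).inv ≫
        (yonedaFP.{max u₁ v₁ u₂} C).map (enrichedEv V B D))) := by
  refine isIso_of_bijective_ap _ fun X => ?_
  refine (Function.Bijective.of_comp_iff _
    (Equiv.ulift.symm : (X ⟶ enrichedHom V B D) ≃ _).bijective).1 ?_
  have h := (yonedaFPEquiv (A := V)).bijective.comp (bijective_enrichedHomEquiv_yonedaLam V C X B D)
  simp only [← yonedaFP_map_comp_mate] at h
  refine Eq.mp (congrArg Function.Bijective (funext fun f => ?_)) h
  exact yonedaFPEquiv_map_comp _ _

/-- The Yoneda embeddings form an embedding of enriched models. -/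
def yonedaEmbedding : DistributiveEnrichedModelEmbedding
    (yonedaFP.{max u₁ u₂ v₂} V) (yonedaFP.{max u₁ v₁ u₂} C) where
  preservesFiniteProducts := inferInstance
  lam := yonedaLam
  lam_naturality := yonedaLam_naturality
  lam_unit := yonedaLam_unit
  lam_assoc := yonedaLam_assoc
  isIso_mate := isIso_mate_yonedaLam V C
  full_left := inferInstance
  faithful_left := inferInstance
  full_right := inferInstance
  faithful_right := inferInstance
  preservesFiniteCoproducts_left :=
    preservesFiniteCoproducts_yonedaFP.{max u₂ v₂}
  preservesFiniteCoproducts_right :=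
    preservesFiniteCoproducts_yonedaFP.{max u₁ v₁}

end Embedding

end ECBV

end

theorem proposition10p3 :
    (∀ (A : Type u) [Category.{v} A] [HasFiniteCoproducts A],
      ECBV.IsFiniteCoproductCocompletion.{max w u v, u, v, max (w + 1) (u + 1) (v + 1),
        max w u v, t} (ECBV.yonedaFP.{max w u} A)) ∧
    (∀ (V : Type u₁) [Category.{v₁} V] [CartesianMonoidalCategory V] [HasFiniteCoproducts V]
      (C : Type u₂) [Category.{v₂} C] [HasFiniteCoproducts C]
      [MonoidalLeftAction V C] [ECBV.IsDistributiveEnrichedModel V C],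
      ∃ (_ : CartesianMonoidalCategory (ECBV.FP.{max u₁ v₁ u₂ v₂} V))
        (_ : MonoidalLeftAction (ECBV.FP.{max u₁ v₁ u₂ v₂} V) (ECBV.FP.{max u₁ v₁ u₂ v₂} C))
        (_ : ECBV.IsClosedEnrichedModel
          (ECBV.FP.{max u₁ v₁ u₂ v₂} V) (ECBV.FP.{max u₁ v₁ u₂ v₂} C)),
        Nonempty (ECBV.DistributiveEnrichedModelEmbedding
          (ECBV.yonedaFP.{max u₁ u₂ v₂} V) (ECBV.yonedaFP.{max u₁ v₁ u₂} C))) :=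
  ⟨fun _ _ _ => ECBV.isFiniteCoproductCocompletion_yonedaFP.{w},
    fun V _ _ _ C _ _ _ _ => ⟨inferInstance, inferInstance, inferInstance,
      ⟨ECBV.yonedaEmbedding V C⟩⟩⟩
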